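/- Let $(M,d)$ be a compact metric space with a Borel probability measure $\mu$ of full support. Let $\Omega=M^{\mathbb N}$ be the space of sequences $x=(x_1,x_2,\dots)$ in $M$, with the metric $d_\Omega(x,y)=\sum_{n\ge 1}2^{-n}d(x_n,y_n)$ and the left shift $\sigma$. For $0<\alpha<1$ let $C^\alpha(\Omega)$ be the space of real $\alpha$-Hölder functions on $\Omega$ with the norm $\|f\|_\alpha=\sup_{x}|f(x)|+\sup_{x\ne y}\frac{|f(x)-f(y)|}{d_\Omega(x,y)^\alpha}$. For $f\in C^\alpha(\Omega)$ let $$(\mathscr L_f\varphi)(x)=\int_M e^{f(ax)}\varphi(ax)\,d\mu(a),\qquad ax=(a,x_1,x_2,\dots),$$ be the Ruelle operator, and let $\lambda_f$ be the maximal modulus of an eigenvalue of $\mathscr L_f$ acting on (complex-valued) $\alpha$-Hölder functions. For a shift-invariant Borel probability measure $\nu$ on $\Omega$ let $$h(\nu)=\inf_{g\in C^\alpha(\Omega)}\Big\{-\int_\Omega g\,d\nu+\log\lambda_g\Big\}\in[-\infty,\infty),\qquad P(f)=\sup_{\nu}\Big\{h(\nu)+\int_\Omega f\,d\nu\Big\},$$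 where the supremum is over all shift-invariant Borel probability measures $\nu$ on $\Omega$. Then $P(f)$ is finite for every $f\in C^\alpha(\Omega)$. For every $f\in C^\alpha(\Omega)$ there are a unique function $h_f\in C^\alpha(\Omega)$ and a unique Borel probability measure $\nu_f$ on $\Omega$ such that $h_f>0$, $\mathscr L_f h_f=\lambda_f h_f$, $\int \mathscr L_f\varphi\,d\nu_f=\lambda_f\int\varphi\,d\nu_f$ for all $\varphi\in C(\Omega)$, and $\int h_f\,d\nu_f=1$. The pressure $P:C^\alpha(\Omega)\to\mathbb R$ is Fréchet differentiable at $f$ with respect to $\|\cdot\|_\alpha$, and its derivative is $$P'(f)\varphi=\int_\Omega\varphi\,h_f\,d\nu_f\qquad\text{for all }\varphi\in C^\alpha(\Omega).$$ -/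

import Mathlib

open MeasureTheory

namespace RuelleThermo

noncomputable section

/-- The metric `d_Ω(x, y) = ∑_{n ≥ 1} 2^{-n} d(x_n, y_n)` on `Ω = M^ℕ`. Sequences are indexed
from `0` here, so that the coordinate of index `n` carries the weight `2^{-(n+1)}`. -/
def seqDist {M : Type*} [MetricSpace M] (x y : ℕ → M) : ℝ :=
  ∑' n : ℕ, (1 / 2 : ℝ) ^ (n + 1) * dist (x n) (y n)

/-- The left shift on `Ω = M^ℕ`. -/
def shift {M : Type*} (x : ℕ → M) : ℕ → M := fun n => x (n + 1)

/-- The sequence `a x = (a, x_1, x_2, …)`. -/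
def consSeq {M : Type*} (a : M) (x : ℕ → M) : ℕ → M
  | 0 => a
  | n + 1 => x n

/-- The Hölder quotients `|φ(x) - φ(y)| / d_Ω(x, y)^α` for `x ≠ y`. -/
def holderQuotients {M E : Type*} [MetricSpace M] [NormedAddCommGroup E] (α : ℝ)
    (φ : (ℕ → M) → E) : Set ℝ :=
  {r | ∃ x y : ℕ → M, x ≠ y ∧ r = ‖φ x - φ y‖ / seqDist x y ^ α}

/-- `φ` is `α`-Hölder: its Hölder quotients are bounded. -/
def IsHolder {M E : Type*} [MetricSpace M] [NormedAddCommGroup E] (α : ℝ)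
    (φ : (ℕ → M) → E) : Prop :=
  BddAbove (holderQuotients α φ)

/-- The Hölder seminorm, the supremum of the Hölder quotients. -/
def hol {M E : Type*} [MetricSpace M] [NormedAddCommGroup E] (α : ℝ)
    (φ : (ℕ → M) → E) : ℝ :=
  sSup (holderQuotients α φ)

section HolderFacts

variable {M E : Type*} [MetricSpace M] [NormedAddCommGroup E]

theorem seqDist_nonneg (x y : ℕ → M) : 0 ≤ seqDist x y :=
  tsum_nonneg fun _ => by positivity

theorem hol_nonneg (α : ℝ) (φ : (ℕ → M) → E) : 0 ≤ hol α φ := by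
  apply Real.sSup_nonneg
  rintro r ⟨x, y, -, rfl⟩
  have := seqDist_nonneg x y
  positivity

theorem hol_le {α : ℝ} {φ : (ℕ → M) → E} {C : ℝ} (hC : 0 ≤ C)
    (h : ∀ x y : ℕ → M, x ≠ y → ‖φ x - φ y‖ / seqDist x y ^ α ≤ C) : hol α φ ≤ C := by
  apply Real.sSup_le _ hC
  rintro r ⟨x, y, hxy, rfl⟩
  exact h x y hxy

theorem isHolder_of_le {α : ℝ} {φ : (ℕ → M) → E} (C : ℝ)
    (h : ∀ x y : ℕ → M, x ≠ y → ‖φ x - φ y‖ / seqDist x y ^ α ≤ C) : IsHolder α φ := by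
  refine ⟨C, ?_⟩
  rintro r ⟨x, y, hxy, rfl⟩
  exact h x y hxy

theorem IsHolder.quotient_le {α : ℝ} {φ : (ℕ → M) → E} (hφ : IsHolder α φ)
    {x y : ℕ → M} (hxy : x ≠ y) : ‖φ x - φ y‖ / seqDist x y ^ α ≤ hol α φ :=
  le_csSup hφ ⟨x, y, hxy, rfl⟩

theorem IsHolder.add_quotient_le {α : ℝ} {φ ψ : (ℕ → M) → E} (hφ : IsHolder α φ)
    (hψ : IsHolder α ψ) {x y : ℕ → M} (hxy : x ≠ y) :
    ‖(φ + ψ) x - (φ + ψ) y‖ / seqDist x y ^ α ≤ hol α φ + hol α ψ := by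
  have h0 : 0 ≤ seqDist x y ^ α := Real.rpow_nonneg (seqDist_nonneg x y) α
  calc ‖(φ + ψ) x - (φ + ψ) y‖ / seqDist x y ^ α
      ≤ (‖φ x - φ y‖ + ‖ψ x - ψ y‖) / seqDist x y ^ α := by
        apply div_le_div_of_nonneg_right _ h0
        have : (φ + ψ) x - (φ + ψ) y = (φ x - φ y) + (ψ x - ψ y) := by
          simp only [Pi.add_apply]; abel
        rw [this]
        exact norm_add_le _ _
    _ ≤ hol α φ + hol α ψ := by
        rw [add_div]
        exact add_le_add (hφ.quotient_le hxy) (hψ.quotient_le hxy)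

theorem IsHolder.smul_quotient_le [NormedSpace ℝ E] {α : ℝ} {φ : (ℕ → M) → E}
    (hφ : IsHolder α φ) (c : ℝ) {x y : ℕ → M} (hxy : x ≠ y) :
    ‖(c • φ) x - (c • φ) y‖ / seqDist x y ^ α ≤ |c| * hol α φ := by
  have : (c • φ) x - (c • φ) y = c • (φ x - φ y) := by
    simp only [Pi.smul_apply, smul_sub]
  rw [this, norm_smul, Real.norm_eq_abs, mul_div_assoc]
  exact mul_le_mul_of_nonneg_left (hφ.quotient_le hxy) (abs_nonneg c)

theorem isHolder_zero (α : ℝ) : IsHolder α (0 : (ℕ → M) → E) :=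
  isHolder_of_le 0 fun x y _ => by simp

theorem hol_zero (α : ℝ) : hol α (0 : (ℕ → M) → E) = 0 :=
  le_antisymm (hol_le le_rfl fun x y _ => by simp) (hol_nonneg _ _)

theorem hol_neg (α : ℝ) (φ : (ℕ → M) → E) : hol α (-φ) = hol α φ := by
  unfold hol holderQuotients
  congr 1
  ext r
  simp only [Pi.neg_apply, neg_sub_neg, norm_sub_rev]

end HolderFacts

/-- The real `α`-Hölder functions, as a subspace of `C(Ω)` (for `M` compact and `α > 0` every
Hölder function is continuous). -/
def holderSubmodule (M : Type*) [MetricSpace M] (α : ℝ) : Submodule ℝ C(ℕ → M, ℝ) where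
  carrier := {f | IsHolder α f}
  add_mem' {f g} hf hg := by
    have hf' : IsHolder α f := hf
    have hg' : IsHolder α g := hg
    exact isHolder_of_le _ fun x y hxy => hf'.add_quotient_le hg' hxy
  zero_mem' := isHolder_zero α
  smul_mem' c f hf := by
    have hf' : IsHolder α f := hf
    exact isHolder_of_le _ fun x y hxy => hf'.smul_quotient_le c hxy

/-- The space `C^α(Ω)`. It is a type of its own, so that it carries the norm
`‖f‖_α = ‖f‖_0 + Hol_α(f)` and not the supremum norm. -/
def HolderSpace (M : Type*) [MetricSpace M] (α : ℝ) : Type _ := holderSubmodule M α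

namespace HolderSpace

variable {M : Type*} [MetricSpace M] {α : ℝ}

instance : AddCommGroup (HolderSpace M α) :=
  inferInstanceAs (AddCommGroup (holderSubmodule M α))

instance : Module ℝ (HolderSpace M α) :=
  inferInstanceAs (Module ℝ (holderSubmodule M α))

/-- The underlying continuous function. -/
def toC (f : HolderSpace M α) : C(ℕ → M, ℝ) := f.1

instance : CoeFun (HolderSpace M α) (fun _ => (ℕ → M) → ℝ) := ⟨fun f => f.toC⟩

theorem isHolder (f : HolderSpace M α) : IsHolder α f := f.2

/-- The norm `‖f‖_α = ‖f‖_0 + Hol_α(f)`. -/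
def groupNorm (M : Type*) [MetricSpace M] [CompactSpace M] (α : ℝ) :
    AddGroupNorm (HolderSpace M α) where
  toFun f := ‖f.toC‖ + hol α f
  map_zero' := by
    have h1 : ‖(0 : HolderSpace M α).toC‖ = 0 := norm_zero
    have h2 : hol α (0 : HolderSpace M α) = 0 := hol_zero α
    rw [h1, h2, add_zero]
  add_le' f g := by
    have h1 : ‖(f + g).toC‖ ≤ ‖f.toC‖ + ‖g.toC‖ := norm_add_le f.toC g.toC
    have h2 : hol α (f + g) ≤ hol α f + hol α g :=
      hol_le (add_nonneg (hol_nonneg _ _) (hol_nonneg _ _)) fun x y hxy =>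
        f.isHolder.add_quotient_le g.isHolder hxy
    linarith
  neg' f := by
    have h1 : ‖(-f).toC‖ = ‖f.toC‖ := norm_neg f.toC
    have h2 : hol α (-f) = hol α f := hol_neg α f
    rw [h1, h2]
  eq_zero_of_map_eq_zero' f hf := by
    have h1 : ‖f.toC‖ = 0 := by
      have := hol_nonneg α f
      have := norm_nonneg f.toC
      linarith
    exact Subtype.ext (norm_eq_zero.mp h1)

instance [CompactSpace M] : NormedAddCommGroup (HolderSpace M α) :=
  (groupNorm M α).toNormedAddCommGroup

theorem norm_def [CompactSpace M] (f : HolderSpace M α) : ‖f‖ = ‖f.toC‖ + hol α f := rfl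

instance [CompactSpace M] : NormedSpace ℝ (HolderSpace M α) where
  norm_smul_le c f := by
    have h1 : ‖(c • f).toC‖ = |c| * ‖f.toC‖ := norm_smul c f.toC
    have h2 : hol α (c • f) ≤ |c| * hol α f :=
      hol_le (mul_nonneg (abs_nonneg c) (hol_nonneg _ _)) fun x y hxy =>
        f.isHolder.smul_quotient_le c hxy
    rw [norm_def, norm_def, Real.norm_eq_abs, h1]
    linarith

end HolderSpace

/-- The Ruelle operator `(L_f φ)(x) = ∫_M e^{f(ax)} φ(ax) dμ(a)`. -/
def ruelle {M E : Type*} [MeasurableSpace M] [NormedAddCommGroup E] [NormedSpace ℝ E]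
    (μ : Measure M) (f : (ℕ → M) → ℝ) (φ : (ℕ → M) → E) : (ℕ → M) → E :=
  fun x => ∫ a, Real.exp (f (consSeq a x)) • φ (consSeq a x) ∂μ

variable {M : Type*} [MetricSpace M] [MeasurableSpace M]

/-- `k ∈ ℂ` is an eigenvalue of the Ruelle operator acting on (complex) `α`-Hölder functions. -/
def IsRuelleEigenvalue (μ : Measure M) (α : ℝ) (f : (ℕ → M) → ℝ) (k : ℂ) : Prop :=
  ∃ φ : (ℕ → M) → ℂ, IsHolder α φ ∧ φ ≠ 0 ∧ ruelle μ f φ = k • φ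

/-- `λ_f`, the maximal modulus of an eigenvalue of the Ruelle operator on `α`-Hölder functions. -/
def maxEigenvalue (μ : Measure M) (α : ℝ) (f : (ℕ → M) → ℝ) : ℝ :=
  sSup {r | ∃ k : ℂ, IsRuelleEigenvalue μ α f k ∧ r = ‖k‖}

/-- `h` and `ν` are the maximal eigenfunction and eigenmeasure of the Ruelle operator `L_f`:
`h > 0`, `L_f h = λ_f h`, `ν` is a probability measure with `L_f^* ν = λ_f ν`, normalized
by `∫ h dν = 1`. -/
structure IsMaximalEigendata (μ : Measure M) {α : ℝ} (f h : HolderSpace M α)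
    (ν : Measure (ℕ → M)) : Prop where
  pos : ∀ x, 0 < h x
  eigenfunction : ∀ x, ruelle μ f h x = maxEigenvalue μ α f * h x
  isProbabilityMeasure : IsProbabilityMeasure ν
  eigenmeasure : ∀ φ : C(ℕ → M, ℝ),
    ∫ x, ruelle μ f φ x ∂ν = maxEigenvalue μ α f * ∫ x, φ x ∂ν
  normalized : ∫ x, h x ∂ν = 1

/-- The set of shift-invariant Borel probability measures on `Ω`. -/
def invariantMeasures (M : Type*) [MeasurableSpace M] : Set (Measure (ℕ → M)) :=
  {ν | IsProbabilityMeasure ν ∧ MeasurePreserving shift ν ν}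

/-- The entropy `h(ν) = inf_{g ∈ C^α(Ω)} (-∫ g dν + log λ_g)`. It can be `-∞`. -/
def entropy (μ : Measure M) (α : ℝ) (ν : Measure (ℕ → M)) : EReal :=
  ⨅ g : HolderSpace M α, ((-∫ x, g x ∂ν + Real.log (maxEigenvalue μ α g) : ℝ) : EReal)

/-- The pressure `P(f) = sup_ν (h(ν) + ∫ f dν)` over the shift-invariant probability measures,
as an extended real number. -/
def pressureE (μ : Measure M) {α : ℝ} (f : HolderSpace M α) : EReal :=
  ⨆ ν ∈ invariantMeasures M, (entropy μ α ν + ((∫ x, f x ∂ν : ℝ) : EReal))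

/-- The pressure functional `P : C^α(Ω) → ℝ`. -/
def pressure (μ : Measure M) {α : ℝ} (f : HolderSpace M α) : ℝ := (pressureE μ f).toReal

end

end RuelleThermo

open MeasureTheory Filter Topology

namespace RuelleThermo

noncomputable section

/-! ### The metric on sequences, Hölder bounds and compactness -/

section Distance

variable {M : Type*} [MetricSpace M]

/-! The pressure at `f` is `log λ_f`, and its derivative comes from squeezing `log λ_{f+φ}` between
two estimates that agree to first order.

A positive Hölder eigenfunction `e^u` with eigenvalue `e^c` is obtained by solving the discounted
equation `log L_f e^{s u} = u` for `s < 1`, where the left side is a sup-norm contraction, and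
letting `s → 1` by Arzelà–Ascoli (`exists_eigenfunction`). A positive supersolution `L_f w ≤ r w`
bounds the modulus of every eigenvalue by `r` (`IsRuelleEigenvalue.norm_le`), so `λ_f = e^c`.
Conjugating by `e^u` and dividing by `e^c` turns `L_f` into a Markov operator `P` with positive
Hölder density. A Doeblin argument combined with the contraction of inverse branches flattens
oscillations under iteration, at a uniform rate on Hölder balls (`exists_contraction`). Hence `P`
has a unique stationary measure `m`, and its continuous fixed points are constants.

Lower estimate: Jensen's inequality for `P`, integrated against `m`, makes `φ ↦ ∫ φ dm` a
subgradient of `log λ` at `f` (`IsLogEigenpair.integral_sub_le`). This also gives `h(m) ≥ log λ_f -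
∫ f dm`; since taking `g = f` in the entropy gives the opposite bound for every `ν`, the pressure
equals `log λ_f`.

Upper estimate: with `ψ = ∑_{j=1}^N P^j φ`, the function `e^{u+ψ}` is a supersolution for `L_{f+φ}`
with constant `exp (c + ∫ φ dm + ε‖φ‖)` once `N` is large and then `‖φ‖` is small
(`IsLogEigenpair.exists_forall_maxEigenvalue_le`). No spectral perturbation theory is involved.

Finally `m = h_f ν_f`: eigendata and stationary measures determine each other, which gives
existence, uniqueness and the formula for the derivative. -/

theorem exists_dist_le (M : Type*) [MetricSpace M] [CompactSpace M] :
    ∃ D : ℝ, 0 ≤ D ∧ ∀ a b : M, dist a b ≤ D :=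
  ⟨Metric.diam (Set.univ : Set M), Metric.diam_nonneg, fun _ _ =>
    Metric.dist_le_diam_of_mem isCompact_univ.isBounded (Set.mem_univ _) (Set.mem_univ _)⟩

theorem summable_half_pow_mul (D : ℝ) : Summable fun n : ℕ => (1 / 2 : ℝ) ^ (n + 1) * D :=
  ((summable_nat_add_iff 1).2
    (summable_geometric_of_lt_one (by norm_num : (0 : ℝ) ≤ 1 / 2) (by norm_num))).mul_right D

theorem summable_seqDist [CompactSpace M] (x y : ℕ → M) :
    Summable fun n : ℕ => (1 / 2 : ℝ) ^ (n + 1) * dist (x n) (y n) := by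
  obtain ⟨D, -, hD⟩ := exists_dist_le M
  exact (summable_half_pow_mul D).of_nonneg_of_le (fun n => by positivity)
    fun n => mul_le_mul_of_nonneg_left (hD _ _) (by positivity)

theorem continuous_seqDist [CompactSpace M] :
    Continuous fun p : (ℕ → M) × (ℕ → M) => seqDist p.1 p.2 := by
  obtain ⟨D, -, hD⟩ := exists_dist_le M
  refine continuous_tsum (u := fun n : ℕ => (1 / 2 : ℝ) ^ (n + 1) * D) (fun n => by fun_prop)
    (summable_half_pow_mul D) fun n p => ?_
  rw [Real.norm_of_nonneg (by positivity)]
  exact mul_le_mul_of_nonneg_left (hD _ _) (by positivity)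

theorem seqDist_self (x : ℕ → M) : seqDist x x = 0 := by simp [seqDist]

theorem coord_le_seqDist [CompactSpace M] (x y : ℕ → M) (n : ℕ) :
    (1 / 2 : ℝ) ^ (n + 1) * dist (x n) (y n) ≤ seqDist x y :=
  (summable_seqDist x y).le_tsum n fun _ _ => by positivity

theorem seqDist_pos [CompactSpace M] {x y : ℕ → M} (h : x ≠ y) : 0 < seqDist x y := by
  obtain ⟨n, hn⟩ := Function.ne_iff.1 h
  have : 0 < dist (x n) (y n) := dist_pos.2 hn
  exact lt_of_lt_of_le (by positivity) (coord_le_seqDist x y n)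

/-- Prepending a symbol is a contraction by one half. Every gain of regularity below comes from the
resulting factor `(1/2)^α`. -/
theorem seqDist_consSeq [CompactSpace M] (a : M) (x y : ℕ → M) :
    seqDist (consSeq a x) (consSeq a y) = 1 / 2 * seqDist x y := by
  rw [seqDist, (summable_seqDist (consSeq a x) (consSeq a y)).tsum_eq_zero_add, seqDist,
    ← tsum_mul_left]
  simp only [consSeq, dist_self, mul_zero, zero_add]
  congr 1
  ext n
  ring

theorem continuous_consSeq : Continuous fun p : M × (ℕ → M) => consSeq p.1 p.2 := by
  refine continuous_pi fun n => ?_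
  cases n with
  | zero => exact continuous_fst
  | succ n => exact (continuous_apply n).comp continuous_snd

theorem continuous_shift : Continuous (shift : (ℕ → M) → ℕ → M) :=
  continuous_pi fun n => continuous_apply (n + 1)

/-- The `α`-th power of the distance on `Ω`. -/
def snowDist (α : ℝ) (x y : ℕ → M) : ℝ := seqDist x y ^ α

theorem snowDist_nonneg (α : ℝ) (x y : ℕ → M) : 0 ≤ snowDist α x y :=
  Real.rpow_nonneg (seqDist_nonneg x y) α

theorem snowDist_comm (α : ℝ) (x y : ℕ → M) : snowDist α x y = snowDist α y x := by
  simp only [snowDist, seqDist, dist_comm]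

theorem snowDist_self {α : ℝ} (hα : 0 < α) (x : ℕ → M) : snowDist α x x = 0 := by
  rw [snowDist, seqDist_self, Real.zero_rpow hα.ne']

theorem snowDist_pos [CompactSpace M] (α : ℝ) {x y : ℕ → M} (h : x ≠ y) : 0 < snowDist α x y :=
  Real.rpow_pos_of_pos (seqDist_pos h) α

theorem snowDist_consSeq [CompactSpace M] (α : ℝ) (a : M) (x y : ℕ → M) :
    snowDist α (consSeq a x) (consSeq a y) = (1 / 2 : ℝ) ^ α * snowDist α x y := by
  rw [snowDist, seqDist_consSeq, Real.mul_rpow (by norm_num) (seqDist_nonneg x y), snowDist]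

theorem continuous_snowDist [CompactSpace M] {α : ℝ} (hα : 0 < α) :
    Continuous fun p : (ℕ → M) × (ℕ → M) => snowDist α p.1 p.2 :=
  continuous_seqDist.rpow_const fun _ => Or.inr hα.le

theorem exists_snowDist_le (M : Type*) [MetricSpace M] [CompactSpace M] {α : ℝ} (hα : 0 < α) :
    ∃ D : ℝ, 0 < D ∧ ∀ x y : ℕ → M, snowDist α x y ≤ D := by
  obtain ⟨D, hD⟩ := (isCompact_univ.image (continuous_snowDist (M := M) hα)).bddAbove
  exact ⟨max D 1, by positivity, fun x y =>
    (hD ⟨(x, y), Set.mem_univ _, rfl⟩).trans (le_max_left _ _)⟩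

theorem half_rpow_pos (α : ℝ) : 0 < (1 / 2 : ℝ) ^ α := Real.rpow_pos_of_pos (by norm_num) α

theorem half_rpow_lt_one {α : ℝ} (hα : 0 < α) : (1 / 2 : ℝ) ^ α < 1 :=
  Real.rpow_lt_one (by norm_num) (by norm_num) hα

/-- `φ` is `α`-Hölder with constant `H`. -/
def HolderBound (α H : ℝ) (φ : (ℕ → M) → ℝ) : Prop :=
  ∀ x y, |φ x - φ y| ≤ H * snowDist α x y

theorem IsHolder.norm_sub_le {E : Type*} [NormedAddCommGroup E] [CompactSpace M] {α : ℝ}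
    {φ : (ℕ → M) → E} (hφ : IsHolder α φ) (x y : ℕ → M) :
    ‖φ x - φ y‖ ≤ hol α φ * snowDist α x y := by
  by_cases h : x = y
  · subst h
    simpa using mul_nonneg (hol_nonneg α φ) (snowDist_nonneg α x x)
  · exact (div_le_iff₀ (snowDist_pos α h)).1 (hφ.quotient_le h)

theorem isHolder_of_norm_sub_le {E : Type*} [NormedAddCommGroup E] [CompactSpace M] {α : ℝ}
    {φ : (ℕ → M) → E} (H : ℝ) (h : ∀ x y, ‖φ x - φ y‖ ≤ H * snowDist α x y) : IsHolder α φ :=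
  isHolder_of_le H fun x y hxy => (div_le_iff₀ (snowDist_pos α hxy)).2 (h x y)

theorem HolderSpace.holderBound [CompactSpace M] {α : ℝ} (f : HolderSpace M α) :
    HolderBound α (hol α f) f :=
  fun x y => f.isHolder.norm_sub_le x y

/-- The element of `C^α(Ω)` given by a continuous function with a Hölder bound. -/
def HolderBound.toHolderSpace [CompactSpace M] {α H : ℝ} {φ : C(ℕ → M, ℝ)}
    (h : HolderBound α H φ) : HolderSpace M α :=
  ⟨φ, isHolder_of_norm_sub_le H h⟩

theorem HolderBound.mono {α H H' : ℝ} {φ : (ℕ → M) → ℝ} (h : HolderBound α H φ) (hH : H ≤ H') :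
    HolderBound α H' φ :=
  fun x y => (h x y).trans (mul_le_mul_of_nonneg_right hH (snowDist_nonneg α x y))

theorem HolderBound.add {α H K : ℝ} {φ ψ : (ℕ → M) → ℝ} (h : HolderBound α H φ)
    (k : HolderBound α K ψ) : HolderBound α (H + K) (φ + ψ) := fun x y => by
  have := abs_add_le (φ x - φ y) (ψ x - ψ y)
  simp only [Pi.add_apply]
  rw [show φ x + ψ x - (φ y + ψ y) = φ x - φ y + (ψ x - ψ y) by ring]
  linarith [h x y, k x y]

theorem HolderBound.mul {α H K A B : ℝ} {φ ψ : (ℕ → M) → ℝ} (h : HolderBound α H φ)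
    (k : HolderBound α K ψ) (hA : ∀ x, |φ x| ≤ A) (hB : ∀ x, |ψ x| ≤ B) :
    HolderBound α (A * K + B * H) (φ * ψ) := fun x y => by
  simp only [Pi.mul_apply]
  rw [show φ x * ψ x - φ y * ψ y = φ x * (ψ x - ψ y) + ψ y * (φ x - φ y) by ring]
  refine (abs_add_le _ _).trans ?_
  rw [abs_mul, abs_mul, add_mul, mul_assoc, mul_assoc]
  exact add_le_add
    (mul_le_mul (hA x) (k x y) (abs_nonneg _) ((abs_nonneg _).trans (hA x)))
    (mul_le_mul (hB y) (h x y) (abs_nonneg _) ((abs_nonneg _).trans (hB y)))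

theorem abs_exp_sub_exp_le {s t B : ℝ} (hs : s ≤ B) (ht : t ≤ B) :
    |Real.exp s - Real.exp t| ≤ Real.exp B * |s - t| := by
  wlog h : t ≤ s generalizing s t
  · rw [abs_sub_comm, abs_sub_comm s]
    exact this ht hs (le_of_not_ge h)
  rw [abs_of_nonneg (sub_nonneg.2 (Real.exp_le_exp.2 h)), abs_of_nonneg (sub_nonneg.2 h)]
  have h1 : Real.exp t = Real.exp s * Real.exp (t - s) := by rw [← Real.exp_add]; congr 1; ring
  have h2 := Real.add_one_le_exp (t - s)
  calc Real.exp s - Real.exp t = Real.exp s * (1 - Real.exp (t - s)) := by rw [h1]; ring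
    _ ≤ Real.exp s * (s - t) := mul_le_mul_of_nonneg_left (by linarith) (Real.exp_pos s).le
    _ ≤ _ := mul_le_mul_of_nonneg_right (Real.exp_le_exp.2 hs) (sub_nonneg.2 h)

theorem HolderBound.exp {α H B : ℝ} {φ : (ℕ → M) → ℝ} (h : HolderBound α H φ)
    (hB : ∀ x, φ x ≤ B) : HolderBound α (Real.exp B * H) fun x => Real.exp (φ x) := fun x y => by
  refine (abs_exp_sub_exp_le (hB x) (hB y)).trans ?_
  rw [mul_assoc]
  exact mul_le_mul_of_nonneg_left (h x y) (Real.exp_pos B).le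

theorem HolderBound.log {α H m : ℝ} {φ : (ℕ → M) → ℝ} (h : HolderBound α H φ) (hm : 0 < m)
    (hφ : ∀ x, m ≤ φ x) : HolderBound α (m⁻¹ * H) fun x => Real.log (φ x) := by
  have key : ∀ x y, Real.log (φ x) - Real.log (φ y) ≤ m⁻¹ * H * snowDist α x y := fun x y => by
    have hx : 0 < φ x := hm.trans_le (hφ x)
    have hy : 0 < φ y := hm.trans_le (hφ y)
    rw [← Real.log_div hx.ne' hy.ne']
    refine (Real.log_le_sub_one_of_pos (div_pos hx hy)).trans ?_
    rw [div_sub_one hy.ne', div_eq_inv_mul, mul_assoc]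
    refine (mul_le_mul_of_nonneg_left ((le_abs_self _).trans (h x y)) (inv_pos.2 hy).le).trans ?_
    exact mul_le_mul_of_nonneg_right (inv_anti₀ hm (hφ y)) ((abs_nonneg _).trans (h x y))
  intro x y
  have h1 := key y x
  rw [snowDist_comm] at h1
  exact abs_le.2 ⟨by linarith, key x y⟩

theorem isClosed_setOf_holderBound (α H : ℝ) :
    IsClosed {u : C(ℕ → M, ℝ) | HolderBound α H u} := by
  simp only [HolderBound, Set.ofPred_forall]
  exact isClosed_iInter fun x => isClosed_iInter fun y => isClosed_le
    ((continuous_eval_const x).sub (continuous_eval_const y)).abs continuous_const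

/-- Arzelà–Ascoli: the Hölder bound gives equicontinuity and, with the value at `x₀` pinned to zero,
a uniform bound because `snowDist` is bounded. -/
theorem isCompact_setOf_holderBound [CompactSpace M] {α : ℝ} (hα : 0 < α) (H : ℝ)
    (x₀ : ℕ → M) : IsCompact {u : C(ℕ → M, ℝ) | HolderBound α H u ∧ u x₀ = 0} := by
  obtain ⟨D, -, hD⟩ := exists_snowDist_le M hα
  set K : Set C(ℕ → M, ℝ) := {u | HolderBound α H u ∧ u x₀ = 0}
  have hcl : IsClosed K := (isClosed_setOf_holderBound α H).inter
    (isClosed_eq (continuous_eval_const x₀) continuous_const)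
  let e := ContinuousMap.equivBoundedOfCompact (ℕ → M) ℝ
  have he : Continuous e.symm := (ContinuousMap.isometryEquivBoundedOfCompact _ _).symm.continuous
  have hA : IsCompact (e.symm ⁻¹' K) := by
    refine BoundedContinuousFunction.arzela_ascoli₂ (Metric.closedBall 0 (|H| * D))
      (isCompact_closedBall _ _) _ (hcl.preimage he) (fun u x hu => ?_) ?_
    · have h1 : |u x - u x₀| ≤ _ := hu.1 x x₀
      have h2 : u x₀ = 0 := hu.2
      rw [h2, sub_zero] at h1
      rw [mem_closedBall_zero_iff, Real.norm_eq_abs]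
      refine h1.trans (mul_le_mul (le_abs_self H) (hD _ _) (snowDist_nonneg _ _ _) (abs_nonneg H))
    · intro x
      rw [Metric.equicontinuousAt_iff_right]
      intro ε hε
      have ht : Tendsto (fun y => H * snowDist α x y) (𝓝 x) (𝓝 0) := by
        have hc : Continuous fun y => H * snowDist α x y :=
          continuous_const.mul ((continuous_snowDist hα).comp (Continuous.prodMk_right x))
        have := hc.tendsto x
        rwa [snowDist_self hα, mul_zero] at this
      filter_upwards [ht.eventually (gt_mem_nhds hε)] with y hy u
      exact (u.2.1 x y).trans_lt hy
  have := hA.image he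
  rwa [Set.image_preimage_eq _ e.symm.surjective] at this

end Distance

/-! ### Averaging operators with a continuous kernel -/

theorem continuous_kernel {M : Type*} [MetricSpace M] (k : C(M × (ℕ → M), ℝ)) (x : ℕ → M) :
    Continuous fun a => k (a, x) := by fun_prop

theorem continuous_comp_consSeq {M : Type*} [MetricSpace M] (φ : C(ℕ → M, ℝ)) (x : ℕ → M) :
    Continuous fun a => φ (consSeq a x) :=
  φ.continuous.comp (continuous_consSeq.comp (Continuous.prodMk_left x))

section Transfer

variable {M : Type*} [MetricSpace M] [CompactSpace M] [MeasurableSpace M] [BorelSpace M]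

theorem integrable_of_continuous {X E : Type*} [TopologicalSpace X] [CompactSpace X]
    [MeasurableSpace X] [OpensMeasurableSpace X] [T2Space X] [NormedAddCommGroup E]
    [SecondCountableTopologyEither X E] {μ : Measure X} [IsFiniteMeasure μ] {f : X → E}
    (hf : Continuous f) : Integrable f μ :=
  hf.integrable_of_hasCompactSupport (HasCompactSupport.of_compactSpace f)

variable (μ : Measure M) [IsProbabilityMeasure μ]

/-- The operator `φ ↦ ∫ k(a, x) φ(ax) dμ(a)` on `C(Ω)`. -/
def transfer (k : C(M × (ℕ → M), ℝ)) (φ : C(ℕ → M, ℝ)) : C(ℕ → M, ℝ) where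
  toFun x := ∫ a, k (a, x) * φ (consSeq a x) ∂μ
  continuous_toFun := by
    have h : Continuous (Function.uncurry fun (x : ℕ → M) (a : M) => k (a, x) * φ (consSeq a x)) :=
      (k.continuous.comp continuous_swap).mul
        (φ.continuous.comp (continuous_consSeq.comp continuous_swap))
    simpa using continuous_parametric_integral_of_continuous (μ := μ) h isCompact_univ

variable (k : C(M × (ℕ → M), ℝ)) (φ ψ : C(ℕ → M, ℝ))

theorem transfer_apply (x : ℕ → M) :
    transfer μ k φ x = ∫ a, k (a, x) * φ (consSeq a x) ∂μ := rfl

theorem integrable_kernel_mul (x : ℕ → M) :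
    Integrable (fun a => k (a, x) * φ (consSeq a x)) μ :=
  integrable_of_continuous ((continuous_kernel k x).mul (continuous_comp_consSeq φ x))

theorem transfer_add : transfer μ k (φ + ψ) = transfer μ k φ + transfer μ k ψ := by
  ext x
  simp only [transfer_apply, ContinuousMap.add_apply, mul_add]
  exact integral_add (integrable_kernel_mul μ k φ x) (integrable_kernel_mul μ k ψ x)

theorem transfer_smul (c : ℝ) : transfer μ k (c • φ) = c • transfer μ k φ := by
  ext x
  simp only [transfer_apply, ContinuousMap.smul_apply, smul_eq_mul, mul_left_comm,
    integral_const_mul]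

variable {φ ψ k}

theorem transfer_mono (hk : ∀ p, 0 ≤ k p) (h : ∀ x, φ x ≤ ψ x) (x : ℕ → M) :
    transfer μ k φ x ≤ transfer μ k ψ x :=
  integral_mono (integrable_kernel_mul μ k φ x) (integrable_kernel_mul μ k ψ x)
    fun _ => mul_le_mul_of_nonneg_left (h _) (hk _)

end Transfer

/-- `k` is a continuous positive transition density, with lower bound `δ`, that is Hölder
continuous in the second variable. -/
structure IsMarkovDensity {M : Type*} [MetricSpace M] [MeasurableSpace M] (μ : Measure M)
    (α δ C : ℝ) (k : C(M × (ℕ → M), ℝ)) : Prop where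
  delta_pos : 0 < δ
  le_apply : ∀ p, δ ≤ k p
  integral_eq_one : ∀ x, ∫ a, k (a, x) ∂μ = 1
  const_nonneg : 0 ≤ C
  holder : ∀ a x y, |k (a, x) - k (a, y)| ≤ C * snowDist α x y

/-- `φ` has oscillation at most `A` and is `α`-Hölder with constant `A * K`. -/
def ModulusBound {M : Type*} [MetricSpace M] (α K A : ℝ) (φ : (ℕ → M) → ℝ) : Prop :=
  (∀ x y, |φ x - φ y| ≤ A) ∧ HolderBound α (A * K) φ

theorem IsMarkovDensity.nonneg {M : Type*} [MetricSpace M] [MeasurableSpace M] {μ : Measure M}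
    {α δ C : ℝ} {k : C(M × (ℕ → M), ℝ)} (hk : IsMarkovDensity μ α δ C k) (p : M × (ℕ → M)) :
    0 ≤ k p :=
  hk.delta_pos.le.trans (hk.le_apply p)

/-! ### Density of Hölder functions -/

section Density

variable {α : ℝ}

/-- The Hölder functions form a subalgebra of `C(Ω)`. -/
def holderSubalgebra (M : Type*) [MetricSpace M] [CompactSpace M] (α : ℝ) :
    Subalgebra ℝ C(ℕ → M, ℝ) where
  carrier := {φ | ∃ H, HolderBound α H φ}
  mul_mem' := by
    rintro φ ψ ⟨H, hH⟩ ⟨K, hK⟩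
    exact ⟨_, hH.mul hK φ.norm_coe_le_norm ψ.norm_coe_le_norm⟩
  add_mem' := by
    rintro φ ψ ⟨H, hH⟩ ⟨K, hK⟩
    exact ⟨_, hH.add hK⟩
  algebraMap_mem' c := ⟨0, fun x y => by simp⟩

theorem holderSubalgebra_separatesPoints (M : Type*) [MetricSpace M] [CompactSpace M]
    (hα0 : 0 < α) (hα1 : α ≤ 1) : (holderSubalgebra M α).SeparatesPoints := by
  intro x y hxy
  obtain ⟨n, hn⟩ := Function.ne_iff.1 hxy
  obtain ⟨D, hD0, hD⟩ := exists_dist_le M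
  let φ : C(ℕ → M, ℝ) := ⟨fun z => dist (z n) (x n), by fun_prop⟩
  -- One constant serves two regimes: for `s ≤ 1`, `α ≤ 1` gives `s ≤ s ^ α`; for `s ≥ 1`, the
  -- diameter bound `D` is enough.
  refine ⟨φ, ⟨φ, ⟨2 ^ (n + 1) * (D + 1), fun u v => ?_⟩, rfl⟩, ?_⟩
  · have h1 : |φ u - φ v| ≤ dist (u n) (v n) := abs_dist_sub_le _ _ _
    have h2 := coord_le_seqDist u v n
    have h3 : dist (u n) (v n) ≤ D := hD _ _
    set s := seqDist u v with hs
    have hs0 : 0 ≤ s := seqDist_nonneg u v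
    have h4 : dist (u n) (v n) ≤ 2 ^ (n + 1) * s := by
      have := mul_le_mul_of_nonneg_left h2 (by positivity : (0 : ℝ) ≤ 2 ^ (n + 1))
      rwa [← mul_assoc, ← mul_pow, show (2 : ℝ) * (1 / 2) = 1 by norm_num, one_pow, one_mul] at this
    have h5 : (1 : ℝ) ≤ 2 ^ (n + 1) := one_le_pow₀ (by norm_num)
    refine h1.trans ?_
    change _ ≤ _ * s ^ α
    rcases le_total s 1 with hs1 | hs1
    · have h6 : s ≤ s ^ α := Real.self_le_rpow_of_le_one hs0 hs1 hα1
      calc dist (u n) (v n) ≤ 2 ^ (n + 1) * s := h4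
        _ ≤ 2 ^ (n + 1) * s ^ α := by gcongr
        _ ≤ 2 ^ (n + 1) * (D + 1) * s ^ α := by
            refine mul_le_mul_of_nonneg_right ?_ (by positivity)
            exact le_mul_of_one_le_right (by positivity) (by linarith)
    · have h6 : 1 ≤ s ^ α := Real.one_le_rpow hs1 hα0.le
      calc dist (u n) (v n) ≤ 1 * (D + 1) * 1 := by linarith
        _ ≤ _ := by gcongr
  · simpa [φ] using hn.symm

/-- Stone–Weierstrass for the Hölder subalgebra. It transfers decay of oscillation from Hölder
functions to all continuous functions. -/
theorem dense_holder (M : Type*) [MetricSpace M] [CompactSpace M] (hα0 : 0 < α) (hα1 : α ≤ 1)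
    (φ : C(ℕ → M, ℝ)) {ε : ℝ} (hε : 0 < ε) :
    ∃ (ψ : C(ℕ → M, ℝ)) (H : ℝ), HolderBound α H ψ ∧ ∀ x, |φ x - ψ x| < ε := by
  obtain ⟨⟨ψ, H, hψ⟩, h⟩ :=
    ContinuousMap.exists_mem_subalgebra_near_continuousMap_of_separatesPoints
    (holderSubalgebra M α) (holderSubalgebra_separatesPoints M hα0 hα1) φ ε hε
  refine ⟨ψ, H, hψ, fun x => ?_⟩
  rw [abs_sub_comm]
  exact (ContinuousMap.norm_coe_le_norm _ x).trans_lt h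

theorem HolderBound.modulusBound {M : Type*} [MetricSpace M] [CompactSpace M] {K H : ℝ}
    (hK : 0 < K) {φ : C(ℕ → M, ℝ)} (hH : HolderBound α H φ) :
    ModulusBound α K (2 * ‖φ‖ + |H| / K) φ := by
  have h0 : 0 ≤ |H| / K := by positivity
  refine ⟨fun x y => ?_, hH.mono ?_⟩
  · have h1 : |φ x| ≤ ‖φ‖ := φ.norm_coe_le_norm x
    have h2 : |φ y| ≤ ‖φ‖ := φ.norm_coe_le_norm y
    exact (abs_sub _ _).trans (by linarith)
  · rw [add_mul, div_mul_cancel₀ _ hK.ne']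
    have : 0 ≤ 2 * ‖φ‖ * K := by positivity
    linarith [le_abs_self H]

end Density

/-! ### Contraction of oscillation for Markov densities -/

namespace IsMarkovDensity

variable {M : Type*} [MetricSpace M] [CompactSpace M] [MeasurableSpace M] [BorelSpace M]
variable {μ : Measure M} [IsProbabilityMeasure μ] {α δ C : ℝ} {k : C(M × (ℕ → M), ℝ)}

theorem transfer_const (hk : IsMarkovDensity μ α δ C k) (c : ℝ) :
    transfer μ k (ContinuousMap.const _ c) = ContinuousMap.const _ c := by
  ext x
  simp [transfer_apply, integral_mul_const, hk.integral_eq_one]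

theorem transfer_le (hk : IsMarkovDensity μ α δ C k) {φ : C(ℕ → M, ℝ)} {c : ℝ}
    (h : ∀ x, φ x ≤ c) (x : ℕ → M) : transfer μ k φ x ≤ c := by
  have := transfer_mono μ hk.nonneg (ψ := ContinuousMap.const _ c) h x
  rwa [hk.transfer_const] at this

theorem le_transfer (hk : IsMarkovDensity μ α δ C k) {φ : C(ℕ → M, ℝ)} {c : ℝ}
    (h : ∀ x, c ≤ φ x) (x : ℕ → M) : c ≤ transfer μ k φ x := by
  have := transfer_mono μ hk.nonneg (φ := ContinuousMap.const _ c) h x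
  rwa [hk.transfer_const] at this

theorem delta_le_one (hk : IsMarkovDensity μ α δ C k) [Nonempty M] : δ ≤ 1 := by
  obtain ⟨a⟩ := ‹Nonempty M›
  have := integral_mono (μ := μ) (integrable_const δ)
    (integrable_of_continuous (continuous_kernel k fun _ => a)) fun b => hk.le_apply _
  simpa [hk.integral_eq_one] using this

/-- Doeblin splitting `k = (k - d) + d`. The first part has mass `1 - d` at either point and sees
only the full oscillation; the second gives every symbol `a` the same weight at `x` and `y`, so it
compares values along the same branch. -/
theorem transfer_sub_le (hk : IsMarkovDensity μ α δ C k) {φ : C(ℕ → M, ℝ)} {A B d : ℝ}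
    (hd : ∀ p, d ≤ k p) (hA : ∀ x y, φ x - φ y ≤ A) (x y : ℕ → M)
    (hB : ∀ a, φ (consSeq a x) - φ (consSeq a y) ≤ B) (hd0 : 0 ≤ d) (hd1 : d ≤ 1) :
    transfer μ k φ x - transfer μ k φ y ≤ (1 - d) * A + d * B := by
  obtain ⟨u, -, hu⟩ := isCompact_univ.exists_isMaxOn ⟨x, Set.mem_univ x⟩ φ.continuous.continuousOn
  obtain ⟨v, -, hv⟩ := isCompact_univ.exists_isMinOn ⟨x, Set.mem_univ x⟩ φ.continuous.continuousOn
  have hu' : ∀ z, φ z ≤ φ u := fun z => hu (Set.mem_univ z)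
  have hv' : ∀ z, φ v ≤ φ z := fun z => hv (Set.mem_univ z)
  have hi : ∀ z, Integrable (fun a => (k (a, z) - d) * φ (consSeq a z)) μ := fun z =>
    integrable_of_continuous
      (((continuous_kernel k z).sub continuous_const).mul (continuous_comp_consSeq φ z))
  have hj : ∀ z, Integrable (fun a => d * φ (consSeq a z)) μ := fun z =>
    integrable_of_continuous (continuous_const.mul (continuous_comp_consSeq φ z))
  have hk1 : ∀ z, Integrable (fun a => k (a, z) - d) μ := fun z =>
    integrable_of_continuous ((continuous_kernel k z).sub continuous_const)
  have hmass : ∀ z, ∫ a, (k (a, z) - d) ∂μ = 1 - d := fun z => by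
    rw [integral_sub (integrable_of_continuous (continuous_kernel k z)) (integrable_const d),
      hk.integral_eq_one]
    simp
  have hsplit : ∀ z, transfer μ k φ z =
      ∫ a, (k (a, z) - d) * φ (consSeq a z) ∂μ + ∫ a, d * φ (consSeq a z) ∂μ := fun z => by
    rw [← integral_add (hi z) (hj z), transfer_apply]
    congr 1
    ext a
    ring
  have h1 : ∫ a, (k (a, x) - d) * φ (consSeq a x) ∂μ ≤ (1 - d) * φ u := by
    rw [← hmass x, ← integral_mul_const]
    exact integral_mono (hi x) ((hk1 x).mul_const _) fun a =>
      mul_le_mul_of_nonneg_left (hu' _) (sub_nonneg.2 (hd _))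
  have h2 : (1 - d) * φ v ≤ ∫ a, (k (a, y) - d) * φ (consSeq a y) ∂μ := by
    rw [← hmass y, ← integral_mul_const]
    exact integral_mono ((hk1 y).mul_const _) (hi y) fun a =>
      mul_le_mul_of_nonneg_left (hv' _) (sub_nonneg.2 (hd _))
  have h3 : ∫ a, d * φ (consSeq a x) ∂μ - ∫ a, d * φ (consSeq a y) ∂μ ≤ d * B := by
    rw [← integral_sub (hj x) (hj y)]
    calc ∫ a, (d * φ (consSeq a x) - d * φ (consSeq a y)) ∂μ ≤ ∫ _, d * B ∂μ :=
          integral_mono ((hj x).sub (hj y)) (integrable_const _) fun a => by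
            have := mul_le_mul_of_nonneg_left (hB a) hd0
            simp only
            linarith
      _ = d * B := by simp
  have h4 : (1 - d) * (φ u - φ v) ≤ (1 - d) * A :=
    mul_le_mul_of_nonneg_left (hA u v) (by linarith)
  rw [hsplit x, hsplit y]
  linarith

theorem abs_transfer_sub_le (hk : IsMarkovDensity μ α δ C k) {φ : C(ℕ → M, ℝ)} {A B d : ℝ}
    (hd : ∀ p, d ≤ k p) (hA : ∀ x y, |φ x - φ y| ≤ A) (x y : ℕ → M)
    (hB : ∀ a, |φ (consSeq a x) - φ (consSeq a y)| ≤ B) (hd0 : 0 ≤ d) (hd1 : d ≤ 1) :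
    |transfer μ k φ x - transfer μ k φ y| ≤ (1 - d) * A + d * B := by
  have hA' : ∀ x y, φ x - φ y ≤ A := fun x y => (le_abs_self _).trans (hA x y)
  have h1 := hk.transfer_sub_le hd hA' x y (fun a => (le_abs_self _).trans (hB a)) hd0 hd1
  have h2 := hk.transfer_sub_le hd hA' y x
    (fun a => (le_abs_self _).trans ((abs_sub_comm _ _).trans_le (hB a))) hd0 hd1
  exact abs_le.2 ⟨by linarith, h1⟩

theorem abs_transfer_sub_le_osc (hk : IsMarkovDensity μ α δ C k) {φ : C(ℕ → M, ℝ)} {A : ℝ}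
    (hA : ∀ x y, |φ x - φ y| ≤ A) (x y : ℕ → M) :
    |transfer μ k φ x - transfer μ k φ y| ≤ A := by
  have := hk.abs_transfer_sub_le (d := 0) hk.nonneg hA x y (fun _ => hA _ _) le_rfl zero_le_one
  linarith

/-- The difference splits into a variation of `φ` along branches, contracted by `(1/2)^α`, and a
variation of the kernel. Since the kernel difference has integral zero, the constant `φ x` may be
subtracted from `φ` in the second term, which is why the oscillation `A` appears instead of the sup
norm. -/
theorem holderBound_transfer (hk : IsMarkovDensity μ α δ C k) {φ : C(ℕ → M, ℝ)} {A H : ℝ}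
    (hA : ∀ x y, |φ x - φ y| ≤ A) (hH : HolderBound α H φ) :
    HolderBound α ((1 / 2 : ℝ) ^ α * H + C * A) (transfer μ k φ) := by
  intro x y
  have h1 : Integrable (fun a => k (a, x) * (φ (consSeq a x) - φ (consSeq a y))) μ :=
    integrable_of_continuous ((continuous_kernel k x).mul
      ((continuous_comp_consSeq φ x).sub (continuous_comp_consSeq φ y)))
  have h2 : Integrable (fun a => (k (a, x) - k (a, y)) * (φ (consSeq a y) - φ x)) μ :=
    integrable_of_continuous (((continuous_kernel k x).sub (continuous_kernel k y)).mul
      ((continuous_comp_consSeq φ y).sub continuous_const))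
  have h3 : ∀ z, Integrable (fun a => k (a, z) * φ x) μ := fun z =>
    integrable_of_continuous ((continuous_kernel k z).mul continuous_const)
  have hsplit : transfer μ k φ x - transfer μ k φ y =
      ∫ a, k (a, x) * (φ (consSeq a x) - φ (consSeq a y)) ∂μ +
        ∫ a, (k (a, x) - k (a, y)) * (φ (consSeq a y) - φ x) ∂μ := by
    have h0 : ∫ a, (k (a, x) * φ x - k (a, y) * φ x) ∂μ = 0 := by
      rw [integral_sub (h3 x) (h3 y), integral_mul_const, integral_mul_const,
        hk.integral_eq_one, hk.integral_eq_one, sub_self]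
    have h4 : Integrable (fun a => k (a, x) * φ x - k (a, y) * φ x) μ := (h3 x).sub (h3 y)
    have h5 : Integrable (fun a => k (a, x) * φ (consSeq a x) - k (a, y) * φ (consSeq a y)) μ :=
      (integrable_kernel_mul μ k φ x).sub (integrable_kernel_mul μ k φ y)
    rw [transfer_apply, transfer_apply, ← integral_sub (integrable_kernel_mul μ k φ x)
      (integrable_kernel_mul μ k φ y), ← integral_add h1 h2, ← sub_zero (∫ a, _ ∂μ), ← h0,
      ← integral_sub h5 h4]
    congr 1
    ext a
    ring
  have b1 : |∫ a, k (a, x) * (φ (consSeq a x) - φ (consSeq a y)) ∂μ| ≤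
      (1 / 2 : ℝ) ^ α * H * snowDist α x y := by
    calc _ ≤ ∫ a, |k (a, x) * (φ (consSeq a x) - φ (consSeq a y))| ∂μ :=
          abs_integral_le_integral_abs
      _ ≤ ∫ a, k (a, x) * ((1 / 2 : ℝ) ^ α * H * snowDist α x y) ∂μ := by
          refine integral_mono h1.abs
            ((integrable_of_continuous (continuous_kernel k x)).mul_const _) fun a => ?_
          simp only [abs_mul, abs_of_nonneg (hk.nonneg _)]
          refine mul_le_mul_of_nonneg_left ?_ (hk.nonneg _)
          refine (hH _ _).trans_eq ?_
          rw [snowDist_consSeq]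
          ring
      _ = _ := by rw [integral_mul_const, hk.integral_eq_one, one_mul]
  have b2 : |∫ a, (k (a, x) - k (a, y)) * (φ (consSeq a y) - φ x) ∂μ| ≤
      C * A * snowDist α x y := by
    calc _ ≤ ∫ a, |(k (a, x) - k (a, y)) * (φ (consSeq a y) - φ x)| ∂μ :=
          abs_integral_le_integral_abs
      _ ≤ ∫ _, C * A * snowDist α x y ∂μ := by
          refine integral_mono h2.abs (integrable_const _) fun a => ?_
          simp only [abs_mul]
          refine (mul_le_mul (hk.holder a x y) (hA _ _) (abs_nonneg _)
            ((abs_nonneg _).trans (hk.holder a x y))).trans_eq ?_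
          ring
      _ = _ := by simp
  rw [hsplit]
  refine (abs_add_le _ _).trans ?_
  linarith

theorem modulusBound_transfer (hk : IsMarkovDensity μ α δ C k) {K ρ A : ℝ}
    (hK : (1 / 2 : ℝ) ^ α * K + C ≤ ρ * K) (hA : 0 ≤ A) {φ : C(ℕ → M, ℝ)}
    (h : ModulusBound α K A φ) :
    (∀ x y, |transfer μ k φ x - transfer μ k φ y| ≤ A) ∧
      HolderBound α (A * (ρ * K)) (transfer μ k φ) := by
  refine ⟨hk.abs_transfer_sub_le_osc h.1, (hk.holderBound_transfer h.1 h.2).mono ?_⟩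
  have := mul_le_mul_of_nonneg_left hK hA
  linarith

/-- After `j` steps the common branches have brought the points closer by `(1/2)^α` to the power
`j`. If they are then within Hölder range `1/2`, the values at the ends of common branches differ by
at most `A / 2`; each step back keeps a fraction `δ` of this gain. -/
theorem abs_iterate_transfer_sub_le (hk : IsMarkovDensity μ α δ C k) [Nonempty M] {K A : ℝ}
    {φ : C(ℕ → M, ℝ)} (h : ModulusBound α K A φ)
    (hA : 0 ≤ A) (j : ℕ) :
    (∀ x y, |(transfer μ k)^[j] φ x - (transfer μ k)^[j] φ y| ≤ A) ∧
    ∀ x y, K * ((1 / 2 : ℝ) ^ α) ^ j * snowDist α x y ≤ 1 / 2 →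
      |(transfer μ k)^[j] φ x - (transfer μ k)^[j] φ y| ≤ A * (1 - δ ^ j / 2) := by
  induction j with
  | zero =>
    refine ⟨h.1, fun x y hxy => (h.2 x y).trans ?_⟩
    have := mul_le_mul_of_nonneg_left hxy hA
    simp only [pow_zero] at this ⊢
    linarith
  | succ j ih =>
    simp only [Function.iterate_succ', Function.comp]
    refine ⟨hk.abs_transfer_sub_le_osc ih.1, fun x y hxy => ?_⟩
    refine (hk.abs_transfer_sub_le (d := δ) hk.le_apply ih.1 x y (B := A * (1 - δ ^ j / 2))
      (fun a => ih.2 _ _ ?_) hk.delta_pos.le hk.delta_le_one).trans_eq (by ring)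
    rw [snowDist_consSeq]
    refine le_of_eq_of_le ?_ hxy
    ring

/-- The Hölder constant and the oscillation are contracted together. The ratio `K` between them is
taken large enough for the kernel term `C * A` to be absorbed, so the Hölder part improves in one
step; the oscillation improves after the number of steps that makes all pairs of points close. -/
theorem exists_contraction (hk : IsMarkovDensity μ α δ C k) [Nonempty M] (hα : 0 < α) :
    ∃ K r : ℝ, ∃ J : ℕ, 0 < K ∧ 0 ≤ r ∧ r < 1 ∧ ∀ (A : ℝ) (φ : C(ℕ → M, ℝ)), 0 ≤ A →
      ModulusBound α K A φ →
      ModulusBound α K A (transfer μ k φ) ∧ ModulusBound α K (A * r) ((transfer μ k)^[J] φ) := by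
  set θ : ℝ := (1 / 2 : ℝ) ^ α with hθ
  have hθ0 : 0 < θ := half_rpow_pos α
  have hθ1 : θ < 1 := half_rpow_lt_one hα
  obtain ⟨D, hD0, hD⟩ := exists_snowDist_le M hα
  have hC := hk.const_nonneg
  -- Chosen so that `(ρ - θ) * K ≥ C` for `ρ` the midpoint of `θ` and `1`; the added `1` keeps `K`
  -- positive when `C = 0`.
  set K : ℝ := 2 * C / (1 - θ) + 1 with hKdef
  have hK0 : 0 < K := by
    have : 0 ≤ 2 * C / (1 - θ) := div_nonneg (by linarith) (by linarith)
    linarith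
  set ρ : ℝ := (1 + θ) / 2 with hρ
  have hKρ : θ * K + C ≤ ρ * K := by
    have h1 : (1 - θ) * K = 2 * C + (1 - θ) := by
      rw [hKdef, mul_add, mul_div_cancel₀ _ (by linarith), mul_one]
    rw [hρ]
    linarith
  have hstep : ∀ (A : ℝ) (φ : C(ℕ → M, ℝ)), 0 ≤ A → ModulusBound α K A φ →
      ModulusBound α K A (transfer μ k φ) := fun A φ hA h => by
    have h1 := hk.modulusBound_transfer hKρ hA h
    refine ⟨h1.1, h1.2.mono (mul_le_mul_of_nonneg_left ?_ hA)⟩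
    have : ρ * K ≤ 1 * K := mul_le_mul_of_nonneg_right (by rw [hρ]; linarith) hK0.le
    linarith
  obtain ⟨J, hJ⟩ : ∃ J : ℕ, K * θ ^ (J + 1) * D ≤ 1 / 2 := by
    have ht : Tendsto (fun n : ℕ => K * θ ^ (n + 1) * D) atTop (𝓝 (K * 0 * D)) :=
      (((tendsto_pow_atTop_nhds_zero_of_lt_one hθ0.le hθ1).comp
        (tendsto_add_atTop_nat 1)).const_mul K).mul_const D
    rw [mul_zero, zero_mul] at ht
    exact (ht.eventually (ge_mem_nhds (by norm_num))).exists
  have hit : ∀ (n : ℕ) (A : ℝ) (φ : C(ℕ → M, ℝ)), 0 ≤ A → ModulusBound α K A φ →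
      ModulusBound α K A ((transfer μ k)^[n] φ) := fun n A φ hA h => by
    induction n with
    | zero => exact h
    | succ n ih =>
      rw [Function.iterate_succ', Function.comp]
      exact hstep A _ hA ih
  have hδ0 : 0 < δ ^ (J + 1) := pow_pos hk.delta_pos _
  have hδ1 : δ ^ (J + 1) ≤ 1 := pow_le_one₀ hk.delta_pos.le hk.delta_le_one
  refine ⟨K, max ρ (1 - δ ^ (J + 1) / 2), J + 1, hK0, le_max_of_le_left (by rw [hρ]; linarith),
    max_lt (by rw [hρ]; linarith) (by linarith), fun A φ hA h => ⟨hstep A φ hA h, ?_, ?_⟩⟩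
  · intro x y
    refine ((hk.abs_iterate_transfer_sub_le h hA (J + 1)).2 x y ?_).trans
      (mul_le_mul_of_nonneg_left (le_max_right _ _) hA)
    exact (mul_le_mul_of_nonneg_left (hD x y) (by positivity)).trans hJ
  · rw [Function.iterate_succ', Function.comp]
    refine (hk.modulusBound_transfer hKρ hA (hit J A φ hA h)).2.mono ?_
    rw [← mul_assoc]
    exact mul_le_mul_of_nonneg_right (mul_le_mul_of_nonneg_left (le_max_left _ _) hA) hK0.le

/-- The point is uniformity: `N` depends on `ε` only, not on `φ` or `A`. Fréchet differentiability
rests on this. -/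
theorem exists_forall_iterate_le (hk : IsMarkovDensity μ α δ C k) [Nonempty M] (hα : 0 < α) :
    ∃ K : ℝ, 0 < K ∧ ∀ ε : ℝ, 0 < ε → ∃ N : ℕ, ∀ n, N ≤ n → ∀ (A : ℝ) (φ : C(ℕ → M, ℝ)), 0 ≤ A →
      ModulusBound α K A φ →
      ∀ x y, |(transfer μ k)^[n] φ x - (transfer μ k)^[n] φ y| ≤ A * ε := by
  obtain ⟨K, r, J, hK, hr0, hr1, h⟩ := hk.exists_contraction hα
  refine ⟨K, hK, fun ε hε => ?_⟩
  obtain ⟨m, hm⟩ := exists_pow_lt_of_lt_one hε hr1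
  refine ⟨J * m, fun n hn A φ hA hφ => ?_⟩
  have h1 : ∀ m, ModulusBound α K (A * r ^ m) ((transfer μ k)^[J * m] φ) := fun m => by
    induction m with
    | zero => simpa using hφ
    | succ m ih =>
      have := (h _ _ (by positivity) ih).2
      rwa [← Function.iterate_add_apply, mul_assoc, ← pow_succ,
        show J + J * m = J * (m + 1) by ring] at this
  have h2 : ∀ i, ModulusBound α K (A * r ^ m) ((transfer μ k)^[i] ((transfer μ k)^[J * m] φ)) :=
    fun i => by
      induction i with
      | zero => exact h1 m
      | succ i ih =>
        rw [Function.iterate_succ', Function.comp]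
        exact (h _ _ (by positivity) ih).1
  have h3 := h2 (n - J * m)
  rw [← Function.iterate_add_apply, Nat.sub_add_cancel hn] at h3
  exact fun x y => (h3.1 x y).trans (mul_le_mul_of_nonneg_left hm.le hA)

theorem abs_iterate_sub_le (hk : IsMarkovDensity μ α δ C k) {φ ψ : C(ℕ → M, ℝ)} {ε : ℝ}
    (h : ∀ x, |φ x - ψ x| ≤ ε) (n : ℕ) :
    ∀ x, |(transfer μ k)^[n] φ x - (transfer μ k)^[n] ψ x| ≤ ε := by
  induction n with
  | zero => exact h
  | succ n ih =>
    intro x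
    simp only [Function.iterate_succ', Function.comp]
    set u := (transfer μ k)^[n] φ
    set v := (transfer μ k)^[n] ψ
    have h1 : transfer μ k u x = transfer μ k v x + transfer μ k (u - v) x := by
      rw [← ContinuousMap.add_apply, ← transfer_add, add_sub_cancel]
    rw [h1, add_sub_cancel_left]
    exact abs_le.2 ⟨hk.le_transfer (fun z => (abs_le.1 (ih z)).1) x,
      hk.transfer_le (fun z => (abs_le.1 (ih z)).2) x⟩

theorem exists_iterate_osc_le (hk : IsMarkovDensity μ α δ C k) [Nonempty M] (hα0 : 0 < α)
    (hα1 : α ≤ 1) (φ : C(ℕ → M, ℝ)) {ε : ℝ} (hε : 0 < ε) :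
    ∃ N : ℕ, ∀ n, N ≤ n → ∀ x y, |(transfer μ k)^[n] φ x - (transfer μ k)^[n] φ y| ≤ ε := by
  obtain ⟨K, hK, h⟩ := hk.exists_forall_iterate_le hα0
  obtain ⟨ψ, H, hψ, hφψ⟩ := dense_holder M hα0 hα1 φ (show 0 < ε / 3 by linarith)
  set A : ℝ := 2 * ‖ψ‖ + |H| / K
  have hA : 0 ≤ A := by positivity
  obtain ⟨N, hN⟩ := h (ε / 3 / (A + 1)) (by positivity)
  refine ⟨N, fun n hn x y => ?_⟩
  have h1 := hN n hn A ψ hA (hψ.modulusBound hK) x y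
  have h2 : A * (ε / 3 / (A + 1)) ≤ ε / 3 := by
    rw [mul_div_left_comm]
    exact mul_le_of_le_one_right (by linarith) ((div_le_one (by linarith)).2 (by linarith))
  have h3 := hk.abs_iterate_sub_le (fun z => (hφψ z).le) n
  have h4 := abs_le.1 (h3 x)
  have h5 := abs_le.1 (h3 y)
  have h6 := abs_le.1 (h1.trans h2)
  exact abs_le.2 ⟨by linarith [h4.1, h4.2, h5.1, h5.2, h6.1, h6.2],
    by linarith [h4.1, h4.2, h5.1, h5.2, h6.1, h6.2]⟩

end IsMarkovDensity

theorem measure_ext_of_integral_eq {M : Type*} [MetricSpace M] [CompactSpace M]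
    [MeasurableSpace M] [BorelSpace M] {m m' : Measure (ℕ → M)} [IsFiniteMeasure m]
    [IsFiniteMeasure m'] (h : ∀ φ : C(ℕ → M, ℝ), ∫ x, φ x ∂m = ∫ x, φ x ∂m') : m = m' :=
  ext_of_forall_integral_eq_of_IsFiniteMeasure fun φ => h φ.toContinuousMap

/-- `m` is a probability measure fixed by the dual of the operator with kernel `k`. -/
structure IsStationary {M : Type*} [MetricSpace M] [CompactSpace M] [MeasurableSpace M]
    [BorelSpace M] (μ : Measure M) [IsProbabilityMeasure μ] (k : C(M × (ℕ → M), ℝ))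
    (m : Measure (ℕ → M)) : Prop where
  isProbabilityMeasure : IsProbabilityMeasure m
  integral_transfer : ∀ φ : C(ℕ → M, ℝ), ∫ x, transfer μ k φ x ∂m = ∫ x, φ x ∂m

/-! ### Convergence of iterates and the stationary measure -/

namespace IsMarkovDensity

variable {M : Type*} [MetricSpace M] [CompactSpace M] [MeasurableSpace M] [BorelSpace M]
variable {μ : Measure M} [IsProbabilityMeasure μ] {α δ C : ℝ} {k : C(M × (ℕ → M), ℝ)}

theorem iterate_mem_Icc (hk : IsMarkovDensity μ α δ C k) {φ : C(ℕ → M, ℝ)} {a b : ℝ}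
    (h : ∀ x, φ x ∈ Set.Icc a b) (n : ℕ) (x : ℕ → M) :
    (transfer μ k)^[n] φ x ∈ Set.Icc a b := by
  induction n generalizing x with
  | zero => exact h x
  | succ n ih =>
    simp only [Function.iterate_succ', Function.comp]
    exact ⟨hk.le_transfer (fun z => (ih z).1) x, hk.transfer_le (fun z => (ih z).2) x⟩

/-- A Markov operator maps functions with values in an interval to functions with values in the same
interval, so later iterates stay within the range of the `N`-th one. -/
theorem abs_iterate_sub_iterate_le (hk : IsMarkovDensity μ α δ C k) {φ : C(ℕ → M, ℝ)} {ε : ℝ}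
    {N n : ℕ} (hn : N ≤ n)
    (h : ∀ x y, |(transfer μ k)^[N] φ x - (transfer μ k)^[N] φ y| ≤ ε) (x y : ℕ → M) :
    |(transfer μ k)^[n] φ y - (transfer μ k)^[N] φ x| ≤ ε := by
  have h1 : ∀ z, (transfer μ k)^[N] φ z ∈ Set.Icc ((transfer μ k)^[N] φ x - ε)
      ((transfer μ k)^[N] φ x + ε) := fun z => by
    have := abs_le.1 (h z x)
    exact ⟨by linarith, by linarith⟩
  have h2 := hk.iterate_mem_Icc h1 (n - N) y
  rw [← Function.iterate_add_apply, Nat.sub_add_cancel hn] at h2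
  exact abs_le.2 ⟨by linarith [h2.1], by linarith [h2.2]⟩

theorem exists_tendsto_iterate (hk : IsMarkovDensity μ α δ C k) [Nonempty M] (hα0 : 0 < α)
    (hα1 : α ≤ 1) (φ : C(ℕ → M, ℝ)) :
    ∃ l : ℝ, ∀ x, Tendsto (fun n => (transfer μ k)^[n] φ x) atTop (𝓝 l) := by
  obtain ⟨a⟩ := ‹Nonempty M›
  have hN : ∀ ε > 0, ∃ N : ℕ, ∀ n, N ≤ n → ∀ x y : ℕ → M,
      |(transfer μ k)^[n] φ x - (transfer μ k)^[N] φ y| ≤ ε := fun ε hε => by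
    have : Nonempty M := ⟨a⟩
    obtain ⟨N, h⟩ := hk.exists_iterate_osc_le hα0 hα1 φ hε
    exact ⟨N, fun n hn x y => hk.abs_iterate_sub_iterate_le hn (h N le_rfl) y x⟩
  have hc : CauchySeq fun n => (transfer μ k)^[n] φ fun _ => a := by
    refine Metric.cauchySeq_iff'.2 fun ε hε => ?_
    obtain ⟨N, h⟩ := hN (ε / 2) (half_pos hε)
    exact ⟨N, fun n hn => (h n hn _ _).trans_lt (half_lt_self hε)⟩
  obtain ⟨l, hl⟩ := cauchySeq_tendsto_of_complete hc
  refine ⟨l, fun x => ?_⟩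
  have h0 : Tendsto (fun n => (transfer μ k)^[n] φ x - (transfer μ k)^[n] φ fun _ => a)
      atTop (𝓝 0) := by
    refine Metric.tendsto_atTop.2 fun ε hε => ?_
    have : Nonempty M := ⟨a⟩
    obtain ⟨N, h⟩ := hk.exists_iterate_osc_le hα0 hα1 φ (half_pos hε)
    refine ⟨N, fun n hn => ?_⟩
    rw [Real.dist_eq, sub_zero]
    exact (h n hn _ _).trans_lt (half_lt_self hε)
  simpa using h0.add hl

theorem iterate_add (n : ℕ) (φ ψ : C(ℕ → M, ℝ)) :
    (transfer μ k)^[n] (φ + ψ) = (transfer μ k)^[n] φ + (transfer μ k)^[n] ψ := by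
  induction n with
  | zero => rfl
  | succ n ih => simp only [Function.iterate_succ', Function.comp, ih, transfer_add]

theorem iterate_smul (n : ℕ) (c : ℝ) (φ : C(ℕ → M, ℝ)) :
    (transfer μ k)^[n] (c • φ) = c • (transfer μ k)^[n] φ := by
  induction n with
  | zero => rfl
  | succ n ih => simp only [Function.iterate_succ', Function.comp, ih, transfer_smul]

/-- The limit of `P^n φ`, which is the same at every point, is a positive linear functional of `φ`,
invariant under `P` and equal to `1` at the constant `1`; Riesz–Markov–Kakutani turns it into the
measure. -/
theorem exists_isStationary (hk : IsMarkovDensity μ α δ C k) [Nonempty M] (hα0 : 0 < α)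
    (hα1 : α ≤ 1) : ∃ m : Measure (ℕ → M), IsStationary μ k m := by
  obtain ⟨a⟩ := ‹Nonempty M›
  have : Nonempty M := ⟨a⟩
  choose l hl using hk.exists_tendsto_iterate hα0 hα1
  let x₀ : ℕ → M := fun _ => a
  let e := CompactlySupportedContinuousMap.continuousMapEquiv (α := ℕ → M) (β := ℝ)
  let Λ : CompactlySupportedContinuousMap (ℕ → M) ℝ →ₚ[ℝ] ℝ := PositiveLinearMap.mk₀
    { toFun := fun φ => l (e.symm φ)
      map_add' := fun φ ψ => by
        refine tendsto_nhds_unique (hl (e.symm (φ + ψ)) x₀) ?_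
        refine ((hl (e.symm φ) x₀).add (hl (e.symm ψ) x₀)).congr fun n => ?_
        rw [← ContinuousMap.add_apply, ← iterate_add]
        rfl
      map_smul' := fun c φ => by
        refine tendsto_nhds_unique (hl (e.symm (c • φ)) x₀) ?_
        refine ((hl (e.symm φ) x₀).const_mul c).congr fun n => ?_
        rw [← smul_eq_mul, ← ContinuousMap.smul_apply, ← iterate_smul]
        rfl }
    fun φ hφ => by
      refine ge_of_tendsto' (hl (e.symm φ) x₀) fun n => ?_
      exact (hk.iterate_mem_Icc (b := ‖e.symm φ‖)
        (fun x => ⟨hφ x, (le_abs_self _).trans ((e.symm φ).norm_coe_le_norm x)⟩) n x₀).1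
  have hint : ∀ φ : C(ℕ → M, ℝ), ∫ x, φ x ∂(RealRMK.rieszMeasure Λ) = l φ := fun φ =>
    RealRMK.integral_rieszMeasure Λ (e φ)
  have hinv : ∀ φ : C(ℕ → M, ℝ), l (transfer μ k φ) = l φ := fun φ => by
    refine tendsto_nhds_unique (hl (transfer μ k φ) x₀) ?_
    refine ((hl φ x₀).comp (tendsto_add_atTop_nat 1)).congr fun n => ?_
    simp only [Function.comp, Function.iterate_succ_apply]
  have hone : l (ContinuousMap.const _ 1) = 1 := by
    refine tendsto_nhds_unique (hl _ x₀) (tendsto_const_nhds.congr fun n => ?_)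
    rw [Function.iterate_fixed (hk.transfer_const 1)]
    rfl
  refine ⟨RealRMK.rieszMeasure Λ, ⟨?_⟩, fun φ => by rw [hint, hint, hinv]⟩
  have h1 := hint (ContinuousMap.const _ 1)
  rw [hone] at h1
  simp only [ContinuousMap.const_apply, integral_const, smul_eq_mul, mul_one, measureReal_def]
    at h1
  exact (ENNReal.toReal_eq_one_iff _).1 h1

theorem integral_iterate {m : Measure (ℕ → M)} (hm : IsStationary μ k m) (φ : C(ℕ → M, ℝ))
    (n : ℕ) : ∫ x, (transfer μ k)^[n] φ x ∂m = ∫ x, φ x ∂m := by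
  induction n with
  | zero => rfl
  | succ n ih =>
    simp only [Function.iterate_succ', Function.comp]
    rw [hm.integral_transfer, ih]

theorem abs_sub_integral_le {m : Measure (ℕ → M)} [IsProbabilityMeasure m] {φ : C(ℕ → M, ℝ)}
    {ε : ℝ} (h : ∀ x y, |φ x - φ y| ≤ ε) (x : ℕ → M) : |φ x - ∫ y, φ y ∂m| ≤ ε := by
  have h1 : φ x - ∫ y, φ y ∂m = ∫ y, (φ x - φ y) ∂m := by
    rw [integral_sub (integrable_const _) (integrable_of_continuous φ.continuous)]
    simp
  rw [h1]
  refine abs_integral_le_integral_abs.trans ?_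
  calc ∫ y, |φ x - φ y| ∂m ≤ ∫ _, ε ∂m := integral_mono
        (integrable_of_continuous (by fun_prop)) (integrable_const _) (h x)
    _ = ε := by simp

theorem isStationary_unique (hk : IsMarkovDensity μ α δ C k) [Nonempty M] (hα0 : 0 < α)
    (hα1 : α ≤ 1) {m m' : Measure (ℕ → M)} (hm : IsStationary μ k m)
    (hm' : IsStationary μ k m') : m = m' := by
  have := hm.isProbabilityMeasure
  have := hm'.isProbabilityMeasure
  obtain ⟨a⟩ := ‹Nonempty M›
  have : Nonempty M := ⟨a⟩
  refine measure_ext_of_integral_eq fun φ => eq_of_abs_sub_le_all fun ε hε => ?_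
  obtain ⟨N, hN⟩ := hk.exists_iterate_osc_le hα0 hα1 φ (half_pos hε)
  have h1 := abs_sub_integral_le (m := m) (hN N le_rfl) fun _ => a
  have h2 := abs_sub_integral_le (m := m') (hN N le_rfl) fun _ => a
  rw [integral_iterate hm] at h1
  rw [integral_iterate hm'] at h2
  rw [abs_sub_comm] at h1
  have := (abs_sub_le _ _ _).trans (add_le_add h1 h2)
  linarith

theorem eq_of_transfer_eq_self (hk : IsMarkovDensity μ α δ C k) [Nonempty M] (hα0 : 0 < α)
    (hα1 : α ≤ 1) {φ : C(ℕ → M, ℝ)} (hφ : transfer μ k φ = φ) (x y : ℕ → M) : φ x = φ y := by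
  refine eq_of_abs_sub_le_all fun ε hε => ?_
  obtain ⟨N, hN⟩ := hk.exists_iterate_osc_le hα0 hα1 φ hε
  have := hN N le_rfl x y
  rwa [Function.iterate_fixed hφ] at this

end IsMarkovDensity

/-! ### Construction of a positive eigenfunction -/

section Eigenfunction

variable {M : Type*} [MetricSpace M]

/-- The kernel `(a, x) ↦ e^{f(ax)}` of the Ruelle operator. -/
def ruelleKernel (f : C(ℕ → M, ℝ)) : C(M × (ℕ → M), ℝ) :=
  ⟨fun p => Real.exp (f (consSeq p.1 p.2)),
    Real.continuous_exp.comp (f.continuous.comp continuous_consSeq)⟩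

/-- The exponential of a continuous function. -/
def expC (u : C(ℕ → M, ℝ)) : C(ℕ → M, ℝ) := ⟨fun x => Real.exp (u x), by fun_prop⟩

@[simp] theorem expC_apply (u : C(ℕ → M, ℝ)) (x : ℕ → M) : expC u x = Real.exp (u x) := rfl

variable [CompactSpace M] [MeasurableSpace M] [BorelSpace M]
variable (μ : Measure M) [IsProbabilityMeasure μ]

theorem transfer_ruelleKernel_expC (f u : C(ℕ → M, ℝ)) (x : ℕ → M) :
    transfer μ (ruelleKernel f) (expC u) x =
      ∫ a, Real.exp (f (consSeq a x) + u (consSeq a x)) ∂μ := by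
  simp only [Real.exp_add]
  rfl

theorem transfer_expC_le {f u v : C(ℕ → M, ℝ)} {c : ℝ} {x y : ℕ → M}
    (h : ∀ a, f (consSeq a x) + u (consSeq a x) ≤ f (consSeq a y) + v (consSeq a y) + c) :
    transfer μ (ruelleKernel f) (expC u) x ≤
      Real.exp c * transfer μ (ruelleKernel f) (expC v) y := by
  rw [transfer_ruelleKernel_expC, transfer_ruelleKernel_expC, ← integral_const_mul]
  have hi : ∀ (w : C(ℕ → M, ℝ)) (z : ℕ → M),
      Integrable (fun a => Real.exp (f (consSeq a z) + w (consSeq a z))) μ := fun w z =>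
    integrable_of_continuous (Real.continuous_exp.comp
      ((continuous_comp_consSeq f z).add (continuous_comp_consSeq w z)))
  refine integral_mono (hi u x) ((hi v y).const_mul _) fun a => ?_
  simp only
  rw [← Real.exp_add]
  exact Real.exp_le_exp.2 (by linarith [h a])

theorem transfer_expC_pos (f u : C(ℕ → M, ℝ)) (x : ℕ → M) :
    0 < transfer μ (ruelleKernel f) (expC u) x := by
  rw [transfer_ruelleKernel_expC]
  exact integral_exp_pos (integrable_of_continuous (Real.continuous_exp.comp
      ((continuous_comp_consSeq f x).add (continuous_comp_consSeq u x))))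

/-- The operator `u ↦ log (L_f e^u)` on `C(Ω)`. -/
def logTransfer (f u : C(ℕ → M, ℝ)) : C(ℕ → M, ℝ) :=
  ⟨fun x => Real.log (transfer μ (ruelleKernel f) (expC u) x),
    (transfer μ (ruelleKernel f) (expC u)).continuous.log
      fun x => (transfer_expC_pos μ f u x).ne'⟩

theorem exp_logTransfer (f u : C(ℕ → M, ℝ)) (x : ℕ → M) :
    Real.exp (logTransfer μ f u x) = transfer μ (ruelleKernel f) (expC u) x :=
  Real.exp_log (transfer_expC_pos μ f u x)

theorem logTransfer_le {f u v : C(ℕ → M, ℝ)} {c : ℝ} {x y : ℕ → M}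
    (h : ∀ a, f (consSeq a x) + u (consSeq a x) ≤ f (consSeq a y) + v (consSeq a y) + c) :
    logTransfer μ f u x ≤ logTransfer μ f v y + c := by
  rw [← Real.exp_le_exp, Real.exp_add, exp_logTransfer, exp_logTransfer, mul_comm]
  exact transfer_expC_le μ h

theorem logTransfer_add_const (f u : C(ℕ → M, ℝ)) (c : ℝ) (x : ℕ → M) :
    logTransfer μ f (u + ContinuousMap.const _ c) x = logTransfer μ f u x + c := by
  refine le_antisymm (logTransfer_le μ fun a => ?_) ?_
  · simp [add_assoc]
  · have := logTransfer_le μ (f := f) (u := u) (v := u + ContinuousMap.const _ c) (c := -c)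
      (x := x) (y := x) fun a => by simp [add_assoc]
    linarith

theorem dist_logTransfer_le (f u v : C(ℕ → M, ℝ)) :
    dist (logTransfer μ f u) (logTransfer μ f v) ≤ dist u v := by
  refine (ContinuousMap.dist_le dist_nonneg).2 fun x => ?_
  have h : ∀ y, |u y - v y| ≤ dist u v := fun y => by
    rw [← Real.dist_eq]
    exact ContinuousMap.dist_apply_le_dist y
  rw [Real.dist_eq]
  refine abs_le.2 ⟨?_, ?_⟩
  · have := logTransfer_le μ (f := f) (u := v) (v := u) (c := dist u v) (x := x) (y := x)
      fun a => by linarith [(abs_le.1 (h (consSeq a x))).1]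
    linarith
  · have := logTransfer_le μ (f := f) (u := u) (v := v) (c := dist u v) (x := x) (y := x)
      fun a => by linarith [(abs_le.1 (h (consSeq a x))).2]
    linarith

theorem holderBound_logTransfer {α F H : ℝ} {f u : C(ℕ → M, ℝ)} (hf : HolderBound α F f)
    (hu : HolderBound α H u) :
    HolderBound α ((1 / 2 : ℝ) ^ α * (F + H)) (logTransfer μ f u) := by
  have h : ∀ x y, logTransfer μ f u x ≤ logTransfer μ f u y +
      (1 / 2 : ℝ) ^ α * (F + H) * snowDist α x y := fun x y => logTransfer_le μ fun a => by
    have h1 := (abs_le.1 (hf (consSeq a x) (consSeq a y))).2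
    have h2 := (abs_le.1 (hu (consSeq a x) (consSeq a y))).2
    rw [snowDist_consSeq] at h1 h2
    linarith
  intro x y
  have h1 := h y x
  rw [snowDist_comm] at h1
  exact abs_le.2 ⟨by linarith, by linarith [h x y]⟩

/-- The factor `s` makes the operator a sup-norm contraction. The constant `H` solves `θ * (F + H) =
H`, so it is preserved by the iteration; crucially it does not depend on `s`. -/
theorem exists_discounted_fixedPoint {α F : ℝ} (hα : 0 < α) {f : C(ℕ → M, ℝ)} (hF : 0 ≤ F)
    (hf : HolderBound α F f) {s : ℝ} (hs0 : 0 ≤ s) (hs1 : s < 1) :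
    ∃ u : C(ℕ → M, ℝ), logTransfer μ f (s • u) = u ∧
      HolderBound α ((1 / 2 : ℝ) ^ α * F / (1 - (1 / 2 : ℝ) ^ α)) u := by
  set θ : ℝ := (1 / 2 : ℝ) ^ α with hθ
  have hθ0 : 0 < θ := half_rpow_pos α
  have hθ1 : θ < 1 := half_rpow_lt_one hα
  set H : ℝ := θ * F / (1 - θ) with hH
  have hH0 : 0 ≤ H := div_nonneg (by positivity) (by linarith)
  have hHθ : θ * (F + H) = H := by
    have : H * (1 - θ) = θ * F := by rw [hH, div_mul_cancel₀ _ (by linarith)]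
    linarith
  let T : C(ℕ → M, ℝ) → C(ℕ → M, ℝ) := fun u => logTransfer μ f (s • u)
  have hT : ContractingWith s.toNNReal T := ⟨Real.toNNReal_lt_one.2 hs1,
    LipschitzWith.of_dist_le_mul fun u v => by
    refine (dist_logTransfer_le μ f _ _).trans ?_
    rw [dist_eq_norm, dist_eq_norm, ← smul_sub, norm_smul, Real.norm_of_nonneg hs0,
      Real.coe_toNNReal s hs0]⟩
  have hmaps : ∀ u : C(ℕ → M, ℝ), HolderBound α H u → HolderBound α H (T u) := fun u hu => by
    rw [← hHθ]
    refine holderBound_logTransfer μ hf fun x y => ?_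
    rw [ContinuousMap.smul_apply, ContinuousMap.smul_apply, ← smul_sub, smul_eq_mul, abs_mul,
      abs_of_nonneg hs0]
    exact (mul_le_of_le_one_left (abs_nonneg _) hs1.le).trans (hu x y)
  refine ⟨ContractingWith.fixedPoint T hT, hT.fixedPoint_isFixedPt, ?_⟩
  refine (isClosed_setOf_holderBound α H).mem_of_tendsto (hT.tendsto_iterate_fixedPoint 0)
    (Eventually.of_forall fun n => ?_)
  induction n with
  | zero => exact fun x y => by simpa using mul_nonneg hH0 (snowDist_nonneg α x y)
  | succ n ih =>
    rw [Function.iterate_succ']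
    exact hmaps _ ih

/-- The discounted solutions may be unbounded as `s → 1`, but their Hölder constants are uniform.
Normalizing them at `x₀` gives a compact family, and a limit point solves the undiscounted equation
up to an additive constant `c`. -/
theorem exists_eigenfunction [Nonempty M] {α F : ℝ} (hα : 0 < α) {f : C(ℕ → M, ℝ)}
    (hf : HolderBound α F f) :
    ∃ (u : C(ℕ → M, ℝ)) (c H : ℝ), HolderBound α H u ∧
      ∀ x, transfer μ (ruelleKernel f) (expC u) x = Real.exp c * Real.exp (u x) := by
  obtain ⟨a⟩ := ‹Nonempty M›
  let x₀ : ℕ → M := fun _ => a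
  set H : ℝ := (1 / 2 : ℝ) ^ α * |F| / (1 - (1 / 2 : ℝ) ^ α)
  let s : ℕ → ℝ := fun n => 1 - 1 / ((n : ℝ) + 1)
  have hs0 : ∀ n, 0 ≤ s n := fun n => sub_nonneg.2
    ((div_le_one (by positivity)).2 (by linarith [Nat.cast_nonneg (α := ℝ) n]))
  have hs1 : ∀ n, s n < 1 := fun n => sub_lt_self _ (by positivity)
  have hs : Tendsto s atTop (𝓝 1) := by
    have := (tendsto_one_div_add_atTop_nhds_zero_nat (𝕜 := ℝ)).const_sub 1
    rwa [sub_zero] at this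
  choose u hu huH using fun n => exists_discounted_fixedPoint μ hα (abs_nonneg F)
    (hf.mono (le_abs_self F)) (hs0 n) (hs1 n)
  let v : ℕ → C(ℕ → M, ℝ) := fun n => u n + ContinuousMap.const _ (-u n x₀)
  have hv : ∀ n, v n ∈ {w : C(ℕ → M, ℝ) | HolderBound α H w ∧ w x₀ = 0} := fun n =>
    ⟨fun x y => by
      simp only [v, ContinuousMap.add_apply, ContinuousMap.const_apply, add_sub_add_right_eq_sub]
      exact huH n x y, by simp [v]⟩
  -- Additive constants pass through `logTransfer`, so the unknown value `u n x₀` cancels in the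
  -- difference.
  have hv_eq : ∀ n x, v n x =
      logTransfer μ f (s n • v n) x - logTransfer μ f (s n • v n) x₀ := fun n x => by
    have h1 : s n • v n = s n • u n + ContinuousMap.const _ (s n * -u n x₀) := by
      ext z
      simp [v]
    rw [h1, logTransfer_add_const, logTransfer_add_const, hu n]
    simp [v, sub_eq_add_neg]
  obtain ⟨w, hw, φ, hφ, hlim⟩ := (isCompact_setOf_holderBound hα H x₀).tendsto_subseq hv
  have hT : Continuous (logTransfer μ f) :=
    (LipschitzWith.of_dist_le_mul (K := 1) fun u v => by
      simpa using dist_logTransfer_le μ f u v).continuous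
  have hlim' : Tendsto (fun n => logTransfer μ f (s (φ n) • v (φ n))) atTop
      (𝓝 (logTransfer μ f w)) := by
    refine (hT.tendsto w).comp ?_
    have := (hs.comp hφ.tendsto_atTop).smul hlim
    rwa [one_smul] at this
  have hev : ∀ (x : ℕ → M) {g : ℕ → C(ℕ → M, ℝ)} {g' : C(ℕ → M, ℝ)},
      Tendsto g atTop (𝓝 g') → Tendsto (fun n => g n x) atTop (𝓝 (g' x)) := fun x g g' h =>
    ((continuous_eval_const x).tendsto g').comp h
  have hw_eq : ∀ x, w x = logTransfer μ f w x - logTransfer μ f w x₀ := fun x => by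
    refine tendsto_nhds_unique (hev x hlim) ?_
    exact ((hev x hlim').sub (hev x₀ hlim')).congr fun n => (hv_eq (φ n) x).symm
  refine ⟨w, logTransfer μ f w x₀, H, hw.1, fun x => ?_⟩
  rw [← exp_logTransfer, ← Real.exp_add]
  congr 1
  linarith [hw_eq x]

end Eigenfunction

theorem le_norm_apply {M : Type*} [MetricSpace M] [CompactSpace M] (u : C(ℕ → M, ℝ))
    (x : ℕ → M) : u x ≤ ‖u‖ :=
  (le_abs_self _).trans (u.norm_coe_le_norm x)

/-- The normalized kernel `e^{f(ax) + u(ax) - u(x) - c}`. -/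
def normKernel {M : Type*} [MetricSpace M] (f u : C(ℕ → M, ℝ)) (c : ℝ) :
    C(M × (ℕ → M), ℝ) where
  toFun p := Real.exp (f (consSeq p.1 p.2) + u (consSeq p.1 p.2) - u p.2 - c)
  continuous_toFun := by
    have h1 := f.continuous.comp (continuous_consSeq (M := M))
    have h2 := u.continuous.comp (continuous_consSeq (M := M))
    exact Real.continuous_exp.comp (((h1.add h2).sub (u.continuous.comp continuous_snd)).sub
      continuous_const)

theorem normKernel_apply {M : Type*} [MetricSpace M] (f u : C(ℕ → M, ℝ)) (c : ℝ)
    (a : M) (x : ℕ → M) :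
    normKernel f u c (a, x) = Real.exp (f (consSeq a x) + u (consSeq a x) - u x - c) := rfl

/-! ### The maximal eigenvalue and normalization -/

section Eigenvalue

variable {M : Type*} [MetricSpace M] [CompactSpace M] [MeasurableSpace M] [BorelSpace M]
variable {μ : Measure M} [IsProbabilityMeasure μ] {α : ℝ}

/-- Comparison: with `S` the supremum of `‖φ‖ / w`, positivity of the operator gives `‖k‖ ‖φ‖ ≤ S
L_f w ≤ S r w`; dividing by `w` and taking the supremum leaves `‖k‖ S ≤ r S`. -/
theorem IsRuelleEigenvalue.norm_le [Nonempty M] (hα : 0 < α) {f w : C(ℕ → M, ℝ)} {r : ℝ}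
    (hw : ∀ x, 0 < w x) (h : ∀ x, transfer μ (ruelleKernel f) w x ≤ r * w x) {k : ℂ}
    (hk : IsRuelleEigenvalue μ α f k) : ‖k‖ ≤ r := by
  obtain ⟨φ, hφ, hφ0, hφk⟩ := hk
  obtain ⟨D, hD0, hD⟩ := exists_snowDist_le M hα
  obtain ⟨z, hz⟩ := Function.ne_iff.1 hφ0
  obtain ⟨v, -, hv⟩ := isCompact_univ.exists_isMinOn ⟨z, Set.mem_univ z⟩ w.continuous.continuousOn
  have hv' : ∀ x, w v ≤ w x := fun x => hv (Set.mem_univ x)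
  have hbdd : BddAbove (Set.range fun x => ‖φ x‖ / w x) := by
    refine ⟨(‖φ z‖ + hol α φ * D) / w v, ?_⟩
    rintro _ ⟨x, rfl⟩
    refine div_le_div₀ (by have := hol_nonneg α φ; positivity) ?_ (hw v) (hv' x)
    have h1 := norm_sub_norm_le (φ x) (φ z)
    have h2 := hφ.norm_sub_le x z
    have h3 := mul_le_mul_of_nonneg_left (hD x z) (hol_nonneg α φ)
    linarith
  set S := ⨆ x, ‖φ x‖ / w x with hS
  have hle : ∀ x, ‖φ x‖ ≤ S * w x := fun x => (div_le_iff₀ (hw x)).1 (le_ciSup hbdd x)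
  have hSpos : 0 < S :=
    lt_of_lt_of_le (div_pos (norm_pos_iff.2 hz) (hw z)) (le_ciSup hbdd z)
  have key : ∀ x, ‖k‖ * ‖φ x‖ ≤ S * (r * w x) := fun x => by
    have h1 : k * φ x = ∫ a, Real.exp (f (consSeq a x)) • φ (consSeq a x) ∂μ :=
      (congrFun hφk x).symm
    rw [← norm_mul, h1]
    refine (norm_integral_le_integral_norm _).trans ?_
    have hi := (integrable_kernel_mul μ (ruelleKernel f) w x).const_mul S
    refine (integral_mono_of_nonneg (Eventually.of_forall fun a => norm_nonneg _) hi
      (Eventually.of_forall fun a => ?_)).trans ?_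
    · simp only [norm_smul, Real.norm_of_nonneg (Real.exp_pos _).le]
      refine (mul_le_mul_of_nonneg_left (hle _) (Real.exp_pos _).le).trans_eq ?_
      change _ = S * (Real.exp (f (consSeq a x)) * w (consSeq a x))
      ring
    · rw [integral_const_mul]
      exact mul_le_mul_of_nonneg_left (h x) hSpos.le
  have h2 : ‖k‖ * S ≤ r * S := by
    rw [hS, Real.mul_iSup_of_nonneg (norm_nonneg k), ← hS]
    have : Nonempty (ℕ → M) := ⟨z⟩
    refine ciSup_le fun x => ?_
    rw [← mul_div_assoc, div_le_iff₀ (hw x)]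
    linarith [key x]
  exact le_of_mul_le_mul_right h2 hSpos

theorem maxEigenvalue_le [Nonempty M] (hα : 0 < α) {f w : C(ℕ → M, ℝ)} {r : ℝ}
    (hw : ∀ x, 0 < w x) (h : ∀ x, transfer μ (ruelleKernel f) w x ≤ r * w x) :
    maxEigenvalue μ α f ≤ r := by
  refine Real.sSup_le ?_ ?_
  · rintro _ ⟨k, hk, rfl⟩
    exact hk.norm_le hα hw h
  -- The real supremum of an empty set is `0`, so `0 ≤ r` has to be verified as well.
  · obtain ⟨a⟩ := ‹Nonempty M›
    refine nonneg_of_mul_nonneg_left ?_ (hw fun _ => a)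
    exact (integral_nonneg fun b => mul_nonneg (Real.exp_pos _).le (hw _).le).trans (h _)

/-- `e^u` is a Hölder eigenfunction of `L_f` for the eigenvalue `e^c`. -/
structure IsLogEigenpair (μ : Measure M) [IsProbabilityMeasure μ] (α : ℝ) (f u : C(ℕ → M, ℝ))
    (c : ℝ) : Prop where
  holder : ∃ H, HolderBound α H u
  eigen : ∀ x, transfer μ (ruelleKernel f) (expC u) x = Real.exp c * Real.exp (u x)

theorem IsLogEigenpair.maxEigenvalue_eq [Nonempty M] (hα : 0 < α) {f u : C(ℕ → M, ℝ)} {c : ℝ}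
    (h : IsLogEigenpair μ α f u c) : maxEigenvalue μ α f = Real.exp c := by
  have hle : ∀ x, transfer μ (ruelleKernel f) (expC u) x ≤ Real.exp c * expC u x :=
    fun x => (h.eigen x).le
  have hpos : ∀ x, 0 < expC u x := fun x => Real.exp_pos _
  refine le_antisymm (maxEigenvalue_le hα hpos hle) (le_csSup ?_ ?_)
  · refine ⟨Real.exp c, ?_⟩
    rintro _ ⟨k, hk, rfl⟩
    exact hk.norm_le hα hpos hle
  · refine ⟨((Real.exp c : ℝ) : ℂ), ⟨fun x => ((Real.exp (u x) : ℝ) : ℂ), ?_, ?_, ?_⟩, ?_⟩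
    · obtain ⟨H, hH⟩ := h.holder
      refine isHolder_of_norm_sub_le (Real.exp ‖u‖ * H) fun x y => ?_
      rw [← Complex.ofReal_sub, Complex.norm_real]
      exact hH.exp (le_norm_apply u) x y
    · obtain ⟨a⟩ := ‹Nonempty M›
      exact Function.ne_iff.2 ⟨fun _ => a, by simp⟩
    · ext x
      have h1 := h.eigen x
      rw [transfer_apply] at h1
      simp only [ruelle, Pi.smul_apply, smul_eq_mul, Complex.real_smul]
      rw [← Complex.ofReal_mul, ← h1, ← integral_complex_ofReal]
      congr 1
      ext a
      rw [← Complex.ofReal_mul]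
      rfl
    · rw [Complex.norm_real, Real.norm_of_nonneg (Real.exp_pos c).le]

theorem transfer_normKernel (f u : C(ℕ → M, ℝ)) (c : ℝ) (φ : C(ℕ → M, ℝ)) (x : ℕ → M) :
    transfer μ (ruelleKernel f) (expC u * φ) x =
      Real.exp (c + u x) * transfer μ (normKernel f u c) φ x := by
  rw [transfer_apply, transfer_apply, ← integral_const_mul]
  congr 1
  ext a
  rw [normKernel_apply, ← mul_assoc, ← Real.exp_add]
  change Real.exp (f (consSeq a x)) * (Real.exp (u (consSeq a x)) * φ (consSeq a x)) = _
  rw [← mul_assoc, ← Real.exp_add]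
  congr 2
  ring

/-- Change of potential: `L_g` acting on a perturbation of `e^u` is expressed through the Markov
operator normalized at `f`. Both the lower and the upper estimate of `λ_g` start here. -/
theorem transfer_ruelleKernel_expC_add (f g u ψ : C(ℕ → M, ℝ)) (c : ℝ) (x : ℕ → M) :
    transfer μ (ruelleKernel g) (expC (u + ψ)) x =
      Real.exp (c + u x) * transfer μ (normKernel f u c) (expC (g - f + ψ)) x := by
  rw [transfer_ruelleKernel_expC, transfer_apply, ← integral_const_mul]
  congr 1
  ext a
  rw [normKernel_apply, expC_apply, ← Real.exp_add, ← Real.exp_add]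
  congr 1
  simp only [ContinuousMap.add_apply, ContinuousMap.sub_apply]
  ring

theorem IsLogEigenpair.isMarkovDensity {f u : C(ℕ → M, ℝ)} {c F : ℝ}
    (h : IsLogEigenpair μ α f u c) (hf : HolderBound α F f) :
    ∃ δ C, IsMarkovDensity μ α δ C (normKernel f u c) := by
  obtain ⟨H, hH⟩ := h.holder
  set B : ℝ := ‖f‖ + ‖u‖ + ‖u‖ + |c|
  set θ : ℝ := (1 / 2 : ℝ) ^ α
  have hθ : 0 < θ := half_rpow_pos α
  have hB : ∀ a x, |f (consSeq a x) + u (consSeq a x) - u x - c| ≤ B := fun a x => by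
    have h1 : |f (consSeq a x)| ≤ ‖f‖ := f.norm_coe_le_norm _
    have h2 : |u (consSeq a x)| ≤ ‖u‖ := u.norm_coe_le_norm _
    have h3 : |u x| ≤ ‖u‖ := u.norm_coe_le_norm _
    refine (abs_sub _ _).trans (add_le_add_left ?_ _)
    refine (abs_sub _ _).trans (add_le_add ?_ h3)
    exact (abs_add_le _ _).trans (add_le_add h1 h2)
  refine ⟨Real.exp (-B), Real.exp B * (θ * |F| + θ * |H| + |H|), Real.exp_pos _, ?_, ?_,
    by positivity, ?_⟩
  · rintro ⟨a, x⟩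
    exact Real.exp_le_exp.2 (abs_le.1 (hB a x)).1
  · intro x
    have h1 := transfer_normKernel (μ := μ) f u c 1 x
    rw [mul_one, h.eigen, ← Real.exp_add] at h1
    have h2 := mul_left_cancel₀ (Real.exp_pos (c + u x)).ne' ((mul_one _).trans h1)
    rw [h2, transfer_apply]
    simp
  · intro a x y
    refine (abs_exp_sub_exp_le (abs_le.1 (hB a x)).2 (abs_le.1 (hB a y)).2).trans ?_
    rw [mul_assoc]
    refine mul_le_mul_of_nonneg_left ?_ (Real.exp_pos B).le
    have h1 := abs_le.1 ((hf.mono (le_abs_self F)) (consSeq a x) (consSeq a y))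
    have h2 := abs_le.1 ((hH.mono (le_abs_self H)) (consSeq a x) (consSeq a y))
    have h3 := abs_le.1 ((hH.mono (le_abs_self H)) x y)
    rw [snowDist_consSeq] at h1 h2
    exact abs_le.2 ⟨by linarith [h1.1, h2.1, h3.2], by linarith [h1.2, h2.2, h3.1]⟩

/-- Jensen's inequality, from the tangent line of `exp` at the mean `b`. -/
theorem IsMarkovDensity.exp_transfer_le {δ C : ℝ} {k : C(M × (ℕ → M), ℝ)}
    (hk : IsMarkovDensity μ α δ C k) (s : C(ℕ → M, ℝ)) (x : ℕ → M) :
    Real.exp (transfer μ k s x) ≤ transfer μ k (expC s) x := by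
  set b := transfer μ k s x with hb
  have h1 : ∀ y, (Real.exp b • (s + ContinuousMap.const (ℕ → M) (1 - b))) y ≤ expC s y :=
      fun y => by
    have h2 := Real.add_one_le_exp (s y - b)
    have h3 : Real.exp (s y) = Real.exp b * Real.exp (s y - b) := by
      rw [← Real.exp_add]
      congr 1
      ring
    simp only [ContinuousMap.smul_apply, ContinuousMap.add_apply, ContinuousMap.const_apply,
      smul_eq_mul, expC_apply]
    rw [h3]
    exact mul_le_mul_of_nonneg_left (by linarith) (Real.exp_pos b).le
  have h4 := transfer_mono μ hk.nonneg h1 x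
  rw [transfer_smul, transfer_add, hk.transfer_const] at h4
  simp only [ContinuousMap.smul_apply, ContinuousMap.add_apply, ContinuousMap.const_apply,
    smul_eq_mul, ← hb] at h4
  linarith

/-- A reverse Jensen inequality with quadratic error: `e^t ≤ 1 + t + t²` for `|t| ≤ 1`, followed by
`1 + t ≤ e^t` after averaging. -/
theorem IsMarkovDensity.transfer_expC_le_exp {δ C τ : ℝ} {k : C(M × (ℕ → M), ℝ)}
    (hk : IsMarkovDensity μ α δ C k) {s : C(ℕ → M, ℝ)} (hs : ∀ x, |s x| ≤ τ) (hτ : τ ≤ 1)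
    (x : ℕ → M) :
    transfer μ k (expC s) x ≤ Real.exp (transfer μ k s x + τ ^ 2) := by
  have h1 : ∀ y, expC s y ≤ (s + ContinuousMap.const (ℕ → M) (1 + τ ^ 2) : C(ℕ → M, ℝ)) y :=
      fun y => by
    have h2 := (abs_le.1 (Real.abs_exp_sub_one_sub_id_le ((hs y).trans hτ))).2
    have h3 : s y ^ 2 ≤ τ ^ 2 := sq_le_sq.2 ((hs y).trans (le_abs_self τ))
    simp only [ContinuousMap.add_apply, ContinuousMap.const_apply, expC_apply]
    linarith
  have h4 := transfer_mono μ hk.nonneg h1 x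
  rw [transfer_add, hk.transfer_const, ContinuousMap.add_apply, ContinuousMap.const_apply] at h4
  have := Real.add_one_le_exp (transfer μ k s x + τ ^ 2)
  linarith

/-- The equilibrium state at `f` gives a subgradient of `log λ`. -/
theorem IsLogEigenpair.integral_sub_le {f g u v : C(ℕ → M, ℝ)} {c d F : ℝ}
    (h : IsLogEigenpair μ α f u c) (hg : IsLogEigenpair μ α g v d) (hf : HolderBound α F f)
    {m : Measure (ℕ → M)} (hm : IsStationary μ (normKernel f u c) m) :
    ∫ x, (g - f) x ∂m ≤ d - c := by
  have := hm.isProbabilityMeasure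
  obtain ⟨δ, C, hk⟩ := h.isMarkovDensity hf
  -- With this `s` the eigenvalue equation for `g` reads `P e^s = e^{d - c} e^{v - u}`. Jensen gives
  -- `P s ≤ v - u + (d - c)`, and stationarity cancels `v - u` on integrating.
  set s : C(ℕ → M, ℝ) := g - f + (v - u) with hs
  have h1 : ∀ x, transfer μ (normKernel f u c) s x ≤
      (v - u + ContinuousMap.const (ℕ → M) (d - c)) x := fun x => by
    have h2 := transfer_ruelleKernel_expC_add (μ := μ) f g u (v - u) c x
    rw [add_sub_cancel, hg.eigen, ← Real.exp_add] at h2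
    have h3 := mul_le_mul_of_nonneg_left (hk.exp_transfer_le s x) (Real.exp_pos (c + u x)).le
    rw [← h2, ← Real.exp_add, Real.exp_le_exp] at h3
    simp only [ContinuousMap.add_apply, ContinuousMap.sub_apply, ContinuousMap.const_apply]
    linarith
  have hi : ∀ φ : C(ℕ → M, ℝ), Integrable (fun x => φ x) m := fun φ =>
    integrable_of_continuous φ.continuous
  have h4 := integral_mono (hi _) (hi _) h1
  rw [hm.integral_transfer] at h4
  simp only [hs, ContinuousMap.add_apply, ContinuousMap.const_apply] at h4
  rw [integral_add (hi (g - f)) (hi (v - u)), integral_add (hi (v - u)) (integrable_const _)] at h4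
  simp only [integral_const, probReal_univ, smul_eq_mul, one_mul] at h4
  linarith

end Eigenvalue

namespace HolderSpace

variable {M : Type*} [MetricSpace M] [CompactSpace M] {α : ℝ}

theorem norm_toC_le (φ : HolderSpace M α) : ‖φ.toC‖ ≤ ‖φ‖ := by
  rw [norm_def]
  linarith [hol_nonneg α φ]

theorem hol_le_norm (φ : HolderSpace M α) : hol α φ ≤ ‖φ‖ := by
  rw [norm_def]
  linarith [norm_nonneg φ.toC]

theorem modulusBound {K : ℝ} (hK : 0 < K) (φ : HolderSpace M α) :
    ModulusBound α K ((2 + 1 / K) * ‖φ‖) φ := by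
  have h1 := φ.holderBound.modulusBound hK
  rw [abs_of_nonneg (hol_nonneg α φ)] at h1
  have h2 : 2 * ‖φ.toC‖ + hol α φ / K ≤ (2 + 1 / K) * ‖φ‖ := by
    have h3 := div_le_div_of_nonneg_right φ.hol_le_norm hK.le
    have h4 : (2 + 1 / K) * ‖φ‖ = 2 * ‖φ‖ + ‖φ‖ / K := by ring
    linarith [φ.norm_toC_le]
  exact ⟨fun x y => (h1.1 x y).trans h2, h1.2.mono (mul_le_mul_of_nonneg_right h2 hK.le)⟩

end HolderSpace

/-! ### Pressure as the logarithm of the eigenvalue, and its derivative -/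

section Pressure

variable {M : Type*} [MetricSpace M] [CompactSpace M] [MeasurableSpace M] [BorelSpace M]
variable {μ : Measure M} [IsProbabilityMeasure μ] {α : ℝ}

/-- The Markov operator is a left inverse of composition with the shift. -/
theorem IsStationary.mem_invariantMeasures {δ C : ℝ} {k : C(M × (ℕ → M), ℝ)}
    (hk : IsMarkovDensity μ α δ C k) {m : Measure (ℕ → M)} (hm : IsStationary μ k m) :
    m ∈ invariantMeasures M := by
  have := hm.isProbabilityMeasure
  have hsm : Measurable (shift : (ℕ → M) → ℕ → M) := continuous_shift.measurable
  refine ⟨hm.isProbabilityMeasure, hsm, ?_⟩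
  have : IsFiniteMeasure (Measure.map shift m) := Measure.isFiniteMeasure_map m shift
  refine measure_ext_of_integral_eq fun φ => ?_
  rw [integral_map hsm.aemeasurable φ.continuous.aestronglyMeasurable]
  let ψ : C(ℕ → M, ℝ) := φ.comp ⟨shift, continuous_shift⟩
  have h1 : transfer μ k ψ = φ := by
    ext x
    have h2 : ∀ a, ψ (consSeq a x) = φ x := fun a => rfl
    simp only [transfer_apply, h2, integral_mul_const, hk.integral_eq_one, one_mul]
  have h3 := hm.integral_transfer ψ
  rw [h1] at h3
  exact h3.symm

/-- Here `ψ` is `∑_{j=1}^n P^j φ`, an approximate solution of the Poisson equation: the remainder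
`P^{n+1} φ` is close to the constant `∫ φ dm` for large `n`. -/
theorem IsMarkovDensity.exists_poisson_sum {δ C : ℝ} {k : C(M × (ℕ → M), ℝ)}
    (hk : IsMarkovDensity μ α δ C k) (φ : C(ℕ → M, ℝ)) (n : ℕ) :
    ∃ ψ : C(ℕ → M, ℝ), transfer μ k (φ + ψ) = ψ + (transfer μ k)^[n + 1] φ ∧
      ∀ x, |(φ + ψ) x| ≤ ((n : ℝ) + 1) * ‖φ‖ := by
  induction n with
  | zero => exact ⟨0, by simp, fun x => by simpa using φ.norm_coe_le_norm x⟩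
  | succ n ih =>
    obtain ⟨ψ, h1, h2⟩ := ih
    refine ⟨ψ + (transfer μ k)^[n + 1] φ, ?_, fun x => ?_⟩
    · rw [← add_assoc, transfer_add, h1, ← Function.iterate_succ_apply' (transfer μ k)]
    · have h3 := hk.iterate_mem_Icc (fun y => abs_le.1 (φ.norm_coe_le_norm y)) (n + 1) x
      rw [← add_assoc, ContinuousMap.add_apply]
      refine (abs_add_le _ _).trans ((add_le_add (h2 x) (abs_le.2 h3)).trans_eq ?_)
      push_cast
      ring

/-- The test function `e^{u+ψ}` is a supersolution for `L_{f+φ}`: the term `ψ` produced by the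
Poisson equation cancels against the test function, leaving `χ` and the quadratic error. -/
theorem IsMarkovDensity.maxEigenvalue_add_le [Nonempty M] (hα0 : 0 < α)
    {f u φ ψ χ : C(ℕ → M, ℝ)} {c δ C τ b : ℝ}
    (h : IsMarkovDensity μ α δ C (normKernel f u c))
    (hψ : transfer μ (normKernel f u c) (φ + ψ) = ψ + χ) (hτ : ∀ x, |(φ + ψ) x| ≤ τ) (hτ1 : τ ≤ 1)
    (hb : ∀ x, χ x + τ ^ 2 ≤ b) : maxEigenvalue μ α (f + φ) ≤ Real.exp (c + b) := by
  refine maxEigenvalue_le (f := f + φ) (w := expC (u + ψ)) hα0 (fun x => Real.exp_pos _)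
    fun x => ?_
  rw [transfer_ruelleKernel_expC_add f, add_sub_cancel_left]
  refine (mul_le_mul_of_nonneg_left (h.transfer_expC_le_exp hτ hτ1 x) (Real.exp_pos _).le).trans ?_
  rw [← Real.exp_add, expC_apply, ← Real.exp_add, Real.exp_le_exp, hψ]
  simp only [ContinuousMap.add_apply]
  linarith [hb x]

theorem IsLogEigenpair.exists_forall_maxEigenvalue_le [Nonempty M] (hα0 : 0 < α)
    {f u : C(ℕ → M, ℝ)} {c F : ℝ} (h : IsLogEigenpair μ α f u c) (hf : HolderBound α F f)
    {m : Measure (ℕ → M)} (hm : IsStationary μ (normKernel f u c) m) {ε : ℝ} (hε : 0 < ε) :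
    ∃ η : ℝ, 0 < η ∧ ∀ φ : HolderSpace M α, ‖φ‖ < η →
      maxEigenvalue μ α (f + φ.toC) ≤ Real.exp (c + ∫ x, φ x ∂m + ε * ‖φ‖) := by
  have := hm.isProbabilityMeasure
  obtain ⟨δ, C, hk⟩ := h.isMarkovDensity hf
  obtain ⟨K, hK, hdecay⟩ := hk.exists_forall_iterate_le hα0
  have hK' : 0 < 2 + 1 / K := by positivity
  obtain ⟨N, hN⟩ := hdecay (ε / 2 / (2 + 1 / K)) (by positivity)
  set P := transfer μ (normKernel f u c) with hP
  -- The error `ε‖φ‖` is shared equally: `N` makes the Poisson remainder at most `ε/2 * ‖φ‖`. For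
  -- this fixed `N`, the first bound on `‖φ‖` ensures `τ ≤ 1` and the second `τ ^ 2 ≤ ε/2 * ‖φ‖`.
  refine ⟨min (1 / ((N : ℝ) + 1)) (ε / 2 / ((N : ℝ) + 1) ^ 2), by positivity, fun φ hφ => ?_⟩
  have hN0 : (0 : ℝ) < (N : ℝ) + 1 := by positivity
  have hφ1 : ‖φ‖ < 1 / ((N : ℝ) + 1) := hφ.trans_le (min_le_left _ _)
  have hφ2 : ‖φ‖ < ε / 2 / ((N : ℝ) + 1) ^ 2 := hφ.trans_le (min_le_right _ _)
  have hsup := φ.norm_toC_le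
  have hφ0 : 0 ≤ ‖φ‖ := norm_nonneg φ
  have hmod := φ.modulusBound hK
  have hosc : ∀ x, |P^[N + 1] φ.toC x - ∫ y, φ y ∂m| ≤ ε / 2 * ‖φ‖ := fun x => by
    have h1 := IsMarkovDensity.abs_sub_integral_le (m := m)
      (hN (N + 1) N.le_succ _ φ.toC (by positivity) hmod) x
    rw [IsMarkovDensity.integral_iterate hm] at h1
    refine h1.trans_eq ?_
    rw [mul_right_comm, mul_div_cancel₀ _ hK'.ne']
  obtain ⟨ψ, hψ, hbound⟩ := hk.exists_poisson_sum φ.toC N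
  set τ : ℝ := ((N : ℝ) + 1) * ‖φ‖ with hτ
  have hτ1 : τ ≤ 1 := by
    have := ((lt_div_iff₀ hN0).1 hφ1).le
    linarith
  have hτ2 : τ ^ 2 ≤ ε / 2 * ‖φ‖ := by
    have h1 := ((lt_div_iff₀ (by positivity)).1 hφ2).le
    have h2 := mul_le_mul_of_nonneg_right h1 hφ0
    rw [hτ]
    linarith
  have h1 := hk.maxEigenvalue_add_le hα0 hψ
    (fun x => (hbound x).trans (mul_le_mul_of_nonneg_left hsup hN0.le)) hτ1
    (b := ∫ x, φ x ∂m + ε * ‖φ‖) fun x => by linarith [(abs_le.1 (hosc x)).2]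
  rwa [← add_assoc] at h1

theorem HolderSpace.exists_isLogEigenpair [Nonempty M] (hα : 0 < α) (f : HolderSpace M α) :
    ∃ u c, IsLogEigenpair μ α f.toC u c := by
  obtain ⟨u, c, H, hH, h⟩ := exists_eigenfunction μ hα f.holderBound
  exact ⟨u, c, ⟨H, hH⟩, h⟩

/-- The upper bound takes `g = f` in the infimum. The lower bound tests the stationary measure `m`,
whose entropy is bounded below by the subgradient inequality over all `g`. -/
theorem IsLogEigenpair.pressureE_eq [Nonempty M] (hα0 : 0 < α) (hα1 : α ≤ 1)
    {f : HolderSpace M α} {u : C(ℕ → M, ℝ)} {c : ℝ} (h : IsLogEigenpair μ α f.toC u c) :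
    pressureE μ f = (c : EReal) := by
  obtain ⟨δ, C, hk⟩ := h.isMarkovDensity f.holderBound
  refine le_antisymm (iSup₂_le fun ν _ => ?_) ?_
  · have h1 : entropy μ α ν ≤ _ := iInf_le _ f
    refine (add_le_add_left h1 _).trans ?_
    rw [← EReal.coe_add, h.maxEigenvalue_eq hα0, Real.log_exp, EReal.coe_le_coe_iff]
    linarith
  · obtain ⟨m, hm⟩ := hk.exists_isStationary hα0 hα1
    have := hm.isProbabilityMeasure
    have h1 : ((c - ∫ x, f x ∂m : ℝ) : EReal) ≤ entropy μ α m := le_iInf fun g => by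
      obtain ⟨v, d, hv⟩ := g.exists_isLogEigenpair (μ := μ) hα0
      have h2 := h.integral_sub_le hv f.holderBound hm
      simp only [ContinuousMap.sub_apply] at h2
      rw [integral_sub (integrable_of_continuous g.toC.continuous)
        (integrable_of_continuous f.toC.continuous)] at h2
      rw [hv.maxEigenvalue_eq hα0, Real.log_exp, EReal.coe_le_coe_iff]
      linarith
    refine le_iSup₂_of_le m (hm.mem_invariantMeasures hk) ?_
    refine le_trans ?_ (add_le_add_left h1 _)
    rw [← EReal.coe_add, sub_add_cancel]

theorem IsLogEigenpair.pressure_eq [Nonempty M] (hα0 : 0 < α) (hα1 : α ≤ 1)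
    {f : HolderSpace M α} {u : C(ℕ → M, ℝ)} {c : ℝ} (h : IsLogEigenpair μ α f.toC u c) :
    pressure μ f = c := by
  rw [pressure, h.pressureE_eq hα0 hα1, EReal.toReal_coe]

/-- Integration against a probability measure, as a continuous functional on `C^α(Ω)`. -/
def integralCLM (α : ℝ) (m : Measure (ℕ → M)) [IsProbabilityMeasure m] : HolderSpace M α →L[ℝ] ℝ :=
  LinearMap.mkContinuous
    { toFun := fun φ => ∫ x, φ x ∂m
      map_add' := fun φ ψ => integral_add (integrable_of_continuous φ.toC.continuous)
        (integrable_of_continuous ψ.toC.continuous)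
      map_smul' := fun c φ => integral_const_mul c fun x => φ x } 1 fun φ => by
    have h1 : ‖∫ x, φ x ∂m‖ ≤ ‖φ.toC‖ * m.real Set.univ :=
      norm_integral_le_of_norm_le_const (Eventually.of_forall fun x => φ.toC.norm_coe_le_norm x)
    rw [probReal_univ, mul_one] at h1
    rw [one_mul, HolderSpace.norm_def]
    exact h1.trans (by linarith [hol_nonneg α φ])

theorem integralCLM_apply (m : Measure (ℕ → M)) [IsProbabilityMeasure m] (φ : HolderSpace M α) :
    integralCLM α m φ = ∫ x, φ x ∂m := rfl

theorem IsLogEigenpair.hasFDerivAt_pressure [Nonempty M] (hα0 : 0 < α) (hα1 : α ≤ 1)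
    {f : HolderSpace M α} {u : C(ℕ → M, ℝ)} {c : ℝ} (h : IsLogEigenpair μ α f.toC u c)
    {m : Measure (ℕ → M)} [IsProbabilityMeasure m]
    (hm : IsStationary μ (normKernel f.toC u c) m) :
    HasFDerivAt (fun g : HolderSpace M α => pressure μ g) (integralCLM α m) f := by
  rw [hasFDerivAt_iff_isLittleO_nhds_zero, Asymptotics.isLittleO_iff]
  intro ε hε
  obtain ⟨η, hη, hle⟩ := h.exists_forall_maxEigenvalue_le hα0 f.holderBound hm hε
  filter_upwards [Metric.ball_mem_nhds (0 : HolderSpace M α) hη] with φ hφ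
  rw [mem_ball_zero_iff] at hφ
  obtain ⟨v, d, hv⟩ := (f + φ).exists_isLogEigenpair (μ := μ) hα0
  have h1 := hle φ hφ
  have h2 : maxEigenvalue μ α (f.toC + φ.toC) = Real.exp d := hv.maxEigenvalue_eq hα0
  rw [h2, Real.exp_le_exp] at h1
  have h3 := h.integral_sub_le hv f.holderBound hm
  have h4 : (f + φ).toC - f.toC = φ.toC := add_sub_cancel_left f.toC φ.toC
  rw [h4] at h3
  rw [hv.pressure_eq hα0 hα1, h.pressure_eq hα0 hα1, integralCLM_apply, Real.norm_eq_abs]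
  exact abs_le.2 ⟨by linarith [mul_nonneg hε.le (norm_nonneg φ)], by linarith⟩

end Pressure

/-- The logarithm of a positive continuous function. -/
def logC {M : Type*} [MetricSpace M] (h : C(ℕ → M, ℝ)) (hpos : ∀ x, 0 < h x) :
    C(ℕ → M, ℝ) :=
  ⟨fun x => Real.log (h x), h.continuous.log fun x => (hpos x).ne'⟩

theorem expC_logC {M : Type*} [MetricSpace M] {h : C(ℕ → M, ℝ)} (hpos : ∀ x, 0 < h x) :
    expC (logC h hpos) = h := by
  ext x
  exact Real.exp_log (hpos x)

theorem normKernel_add_const {M : Type*} [MetricSpace M] (f u : C(ℕ → M, ℝ)) (c t : ℝ) :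
    normKernel f (u + ContinuousMap.const _ t) c = normKernel f u c := by
  ext ⟨a, x⟩
  simp only [normKernel_apply, ContinuousMap.add_apply, ContinuousMap.const_apply]
  congr 1
  ring

/-! ### Existence and uniqueness of the eigendata -/

section Eigendata

variable {M : Type*} [MetricSpace M] [CompactSpace M] [MeasurableSpace M] [BorelSpace M]

/-- The measure with continuous density `w` with respect to `ν`. -/
def weighted (ν : Measure (ℕ → M)) (w : C(ℕ → M, ℝ)) : Measure (ℕ → M) :=
  ν.withDensity fun x => ENNReal.ofReal (w x)

theorem integral_weighted (ν : Measure (ℕ → M)) {w : C(ℕ → M, ℝ)} (hw : ∀ x, 0 < w x)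
    (φ : (ℕ → M) → ℝ) : ∫ x, φ x ∂(weighted ν w) = ∫ x, w x * φ x ∂ν := by
  rw [weighted, integral_withDensity_eq_integral_toReal_smul
    (w.continuous.measurable.ennreal_ofReal) (Eventually.of_forall fun x => ENNReal.ofReal_lt_top)]
  congr 1
  ext x
  rw [ENNReal.toReal_ofReal (hw x).le, smul_eq_mul]

theorem isProbabilityMeasure_weighted {ν : Measure (ℕ → M)} {w : C(ℕ → M, ℝ)}
    (hw : ∀ x, 0 < w x) (h : ∫ x, w x ∂ν = 1) : IsProbabilityMeasure (weighted ν w) := by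
  constructor
  have h1 := integral_weighted ν hw fun _ => 1
  simp only [mul_one, h, integral_const, smul_eq_mul, measureReal_def] at h1
  exact (ENNReal.toReal_eq_one_iff _).1 h1

variable {μ : Measure M} [IsProbabilityMeasure μ] {α : ℝ}

theorem IsMaximalEigendata.exists_isLogEigenpair [Nonempty M] (hα : 0 < α)
    {f h : HolderSpace M α} {ν : Measure (ℕ → M)} (hd : IsMaximalEigendata μ f h ν) :
    IsLogEigenpair μ α f.toC (logC h.toC hd.pos) (Real.log (maxEigenvalue μ α f)) := by
  obtain ⟨u, c, hu⟩ := f.exists_isLogEigenpair (μ := μ) hα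
  obtain ⟨a⟩ := ‹Nonempty M›
  obtain ⟨v, -, hv⟩ := isCompact_univ.exists_isMinOn ⟨fun _ => a, Set.mem_univ _⟩
    h.toC.continuous.continuousOn
  refine ⟨⟨_, h.holderBound.log (hd.pos v) fun x => hv (Set.mem_univ x)⟩, fun x => ?_⟩
  rw [expC_logC, Real.exp_log (by have : Nonempty M := ⟨a⟩
                                  rw [hu.maxEigenvalue_eq hα]; exact Real.exp_pos c)]
  refine (hd.eigenfunction x).trans ?_
  congr 1
  exact (Real.exp_log (hd.pos x)).symm

/-- Applying the eigenmeasure identity to `e^u φ`, and using `L_f (e^u φ) = e^c e^u P φ`, shows that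
`e^u ν` is fixed by the dual of `P`. -/
theorem isStationary_weighted {f u : C(ℕ → M, ℝ)} {c : ℝ} {ν : Measure (ℕ → M)}
    (hν : ∀ φ : C(ℕ → M, ℝ),
      ∫ x, transfer μ (ruelleKernel f) φ x ∂ν = Real.exp c * ∫ x, φ x ∂ν)
    (hu : ∫ x, expC u x ∂ν = 1) :
    IsStationary μ (normKernel f u c) (weighted ν (expC u)) := by
  have hpos : ∀ x, 0 < expC u x := fun x => Real.exp_pos _
  refine ⟨isProbabilityMeasure_weighted hpos hu, fun φ => ?_⟩
  rw [integral_weighted ν hpos, integral_weighted ν hpos]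
  have h1 := hν (expC u * φ)
  simp only [transfer_normKernel f u c, Real.exp_add, mul_assoc] at h1
  rw [integral_const_mul] at h1
  exact mul_left_cancel₀ (Real.exp_pos c).ne' h1

theorem integral_transfer_weighted {f u : C(ℕ → M, ℝ)} {c : ℝ} {m : Measure (ℕ → M)}
    (hm : IsStationary μ (normKernel f u c) m) (φ : C(ℕ → M, ℝ)) :
    ∫ x, transfer μ (ruelleKernel f) φ x ∂(weighted m (expC (-u))) =
      Real.exp c * ∫ x, φ x ∂(weighted m (expC (-u))) := by
  have hpos : ∀ x, 0 < expC (-u) x := fun x => Real.exp_pos _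
  rw [integral_weighted m hpos, integral_weighted m hpos]
  have h1 : φ = expC u * (expC (-u) * φ) := by
    ext x
    simp only [ContinuousMap.mul_apply, expC_apply, ContinuousMap.neg_apply]
    rw [← mul_assoc, ← Real.exp_add, add_neg_cancel, Real.exp_zero, one_mul]
  have h2 : ∀ x, expC (-u) x * transfer μ (ruelleKernel f) φ x =
      Real.exp c * transfer μ (normKernel f u c) (expC (-u) * φ) x := fun x => by
    conv_lhs => rw [h1]
    rw [transfer_normKernel, ← mul_assoc, expC_apply, ← Real.exp_add, ContinuousMap.neg_apply]
    congr 2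
    ring
  simp only [h2]
  rw [integral_const_mul, hm.integral_transfer]
  rfl

theorem IsLogEigenpair.add_const {f u : C(ℕ → M, ℝ)} {c : ℝ} (h : IsLogEigenpair μ α f u c)
    (t : ℝ) : IsLogEigenpair μ α f (u + ContinuousMap.const _ t) c := by
  obtain ⟨H, hH⟩ := h.holder
  refine ⟨⟨H, fun x y => by simpa using hH x y⟩, fun x => ?_⟩
  have h1 : expC (u + ContinuousMap.const _ t) = Real.exp t • expC u := by
    ext y
    simp [Real.exp_add, mul_comm]
  rw [h1, transfer_smul, ContinuousMap.smul_apply, h.eigen, ContinuousMap.add_apply, Real.exp_add,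
    ContinuousMap.const_apply, smul_eq_mul]
  ring

/-- The quotient `e^{v-u}` of two eigenfunctions is fixed by the normalized operator, hence
constant. -/
theorem IsLogEigenpair.exists_eq_add_const [Nonempty M] (hα0 : 0 < α) (hα1 : α ≤ 1)
    {f u v : C(ℕ → M, ℝ)} {c F : ℝ} (hf : HolderBound α F f) (h : IsLogEigenpair μ α f u c)
    (h' : IsLogEigenpair μ α f v c) : ∃ t : ℝ, v = u + ContinuousMap.const _ t := by
  obtain ⟨δ, C, hk⟩ := h.isMarkovDensity hf
  have h1 : transfer μ (normKernel f u c) (expC (v - u)) = expC (v - u) := by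
    ext x
    have h2 := transfer_ruelleKernel_expC_add (μ := μ) f f u (v - u) c x
    rw [add_sub_cancel, sub_self, zero_add, h'.eigen, ← Real.exp_add] at h2
    refine mul_left_cancel₀ (Real.exp_pos (c + u x)).ne' (h2.symm.trans ?_)
    rw [expC_apply, ← Real.exp_add, ContinuousMap.sub_apply]
    congr 1
    ring
  obtain ⟨a⟩ := ‹Nonempty M›
  have : Nonempty M := ⟨a⟩
  refine ⟨v (fun _ => a) - u fun _ => a, ?_⟩
  ext x
  have h2 := Real.exp_injective (hk.eq_of_transfer_eq_self hα0 hα1 h1 x fun _ => a)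
  simp only [ContinuousMap.sub_apply] at h2
  simp only [ContinuousMap.add_apply, ContinuousMap.const_apply]
  linarith

theorem IsMaximalEigendata.isStationary [Nonempty M] (hα : 0 < α)
    {f h : HolderSpace M α} {ν : Measure (ℕ → M)} (hd : IsMaximalEigendata μ f h ν) :
    IsStationary μ (normKernel f.toC (logC h.toC hd.pos) (Real.log (maxEigenvalue μ α f)))
      (weighted ν h.toC) := by
  obtain ⟨u, c, hu⟩ := f.exists_isLogEigenpair (μ := μ) hα
  have hc : 0 < maxEigenvalue μ α f := by
    rw [hu.maxEigenvalue_eq hα]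
    exact Real.exp_pos c
  have h1 := isStationary_weighted (μ := μ) (f := f.toC) (u := logC h.toC hd.pos)
    (c := Real.log (maxEigenvalue μ α f)) (ν := ν) (fun φ => ?_) ?_
  · rwa [expC_logC] at h1
  · rw [Real.exp_log hc]
    exact hd.eigenmeasure φ
  · rw [expC_logC]
    exact hd.normalized

theorem exists_isMaximalEigendata [Nonempty M] (μ : Measure M) [IsProbabilityMeasure μ]
    (hα0 : 0 < α) (hα1 : α ≤ 1) (f : HolderSpace M α) :
    ∃ (h : HolderSpace M α) (ν : Measure (ℕ → M)), IsMaximalEigendata μ f h ν := by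
  obtain ⟨u₀, c, hu₀⟩ := f.exists_isLogEigenpair (μ := μ) hα0
  obtain ⟨δ, C, hk⟩ := hu₀.isMarkovDensity f.holderBound
  obtain ⟨m, hm⟩ := hk.exists_isStationary hα0 hα1
  have := hm.isProbabilityMeasure
  set Z : ℝ := ∫ x, expC (-u₀) x ∂m with hZ
  have hZpos : 0 < Z := integral_exp_pos (integrable_of_continuous (expC (-u₀)).continuous)
  -- The shift by `log Z` makes `e^{-u} m` a probability measure. It leaves the normalized kernel,
  -- and hence `m`, unchanged, and `∫ e^u d(e^{-u} m) = 1` is then automatic.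
  set u : C(ℕ → M, ℝ) := u₀ + ContinuousMap.const _ (Real.log Z) with hu
  have hpair : IsLogEigenpair μ α f.toC u c := hu₀.add_const _
  rw [← normKernel_add_const f.toC u₀ c (Real.log Z), ← hu] at hm
  obtain ⟨H, hH⟩ := hpair.holder
  have hpos : ∀ x, 0 < expC (-u) x := fun x => Real.exp_pos _
  have hmass : ∫ x, expC (-u) x ∂m = 1 := by
    have h1 : ∀ x, expC (-u) x = Z⁻¹ * expC (-u₀) x := fun x => by
      simp only [expC_apply, hu, ContinuousMap.neg_apply, ContinuousMap.add_apply,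
        ContinuousMap.const_apply]
      rw [neg_add, Real.exp_add, Real.exp_neg (Real.log Z), Real.exp_log hZpos, mul_comm]
    simp only [h1]
    rw [integral_const_mul, ← hZ, inv_mul_cancel₀ hZpos.ne']
  have hexp : HolderBound α (Real.exp ‖u‖ * H) (expC u) := hH.exp (le_norm_apply u)
  have hmax : maxEigenvalue μ α f = Real.exp c := hpair.maxEigenvalue_eq hα0
  refine ⟨hexp.toHolderSpace, weighted m (expC (-u)), ⟨fun x => Real.exp_pos _, fun x => ?_,
    isProbabilityMeasure_weighted hpos hmass, fun φ => ?_, ?_⟩⟩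
  · rw [hmax]
    exact hpair.eigen x
  · rw [hmax]
    exact integral_transfer_weighted hm φ
  · rw [integral_weighted m hpos]
    have h1 : ∀ x, expC (-u) x * expC u x = 1 := fun x => by
      rw [expC_apply, expC_apply, ← Real.exp_add, ContinuousMap.neg_apply, neg_add_cancel,
        Real.exp_zero]
    change ∫ x, expC (-u) x * expC u x ∂m = 1
    simp only [h1]
    simp

/-- Both eigenfunctions give the same normalized kernel, so `h ν = h' ν'` by uniqueness of the
stationary measure. With `h' = e^t h` this means `ν = e^t ν'`, and equality of total masses forces
`e^t = 1`. -/
theorem IsMaximalEigendata.unique [Nonempty M] (hα0 : 0 < α) (hα1 : α ≤ 1)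
    {f h h' : HolderSpace M α} {ν ν' : Measure (ℕ → M)} (hd : IsMaximalEigendata μ f h ν)
    (hd' : IsMaximalEigendata μ f h' ν') : h = h' ∧ ν = ν' := by
  have := hd.isProbabilityMeasure
  have := hd'.isProbabilityMeasure
  have hp := hd.exists_isLogEigenpair hα0
  obtain ⟨t, ht⟩ := hp.exists_eq_add_const hα0 hα1 f.holderBound (hd'.exists_isLogEigenpair hα0)
  obtain ⟨δ, C, hk⟩ := hp.isMarkovDensity f.holderBound
  have hm := hd.isStationary hα0
  have hm' := hd'.isStationary hα0
  rw [ht, normKernel_add_const] at hm'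
  have hmm := hk.isStationary_unique hα0 hα1 hm hm'
  have hh : ∀ x, h' x = Real.exp t * h x := fun x => by
    have h1 : Real.log (h' x) = Real.log (h x) + t := DFunLike.congr_fun ht x
    rw [← Real.exp_log (hd'.pos x), h1, Real.exp_add, Real.exp_log (hd.pos x), mul_comm]
  have hint : ∀ φ : C(ℕ → M, ℝ), ∫ x, φ x ∂ν = Real.exp t * ∫ x, φ x ∂ν' := fun φ => by
    have h1 := integral_weighted ν hd.pos fun x => (h x)⁻¹ * φ x
    have h2 := integral_weighted ν' hd'.pos fun x => (h x)⁻¹ * φ x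
    rw [hmm, h2] at h1
    have h3 : ∀ x, h.toC x * ((h x)⁻¹ * φ x) = φ x := fun x =>
      mul_inv_cancel_left₀ (hd.pos x).ne' _
    have h4 : ∀ x, h'.toC x * ((h x)⁻¹ * φ x) = Real.exp t * φ x := fun x => by
      rw [hh x, mul_assoc, mul_inv_cancel_left₀ (hd.pos x).ne']
    simp only [h3, h4] at h1
    rw [← h1, integral_const_mul]
  have ht1 : Real.exp t = 1 := by
    have h1 := hint (ContinuousMap.const _ 1)
    simpa using h1.symm
  refine ⟨Subtype.ext (ContinuousMap.ext fun x => ?_), measure_ext_of_integral_eq fun φ => ?_⟩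
  · have h1 := hh x
    rw [ht1, one_mul] at h1
    exact h1.symm
  · rw [hint, ht1, one_mul]

theorem IsMaximalEigendata.hasFDerivAt_pressure [Nonempty M] (hα0 : 0 < α) (hα1 : α ≤ 1)
    {f h : HolderSpace M α} {ν : Measure (ℕ → M)} (hd : IsMaximalEigendata μ f h ν) :
    ∃ L : HolderSpace M α →L[ℝ] ℝ, (∀ φ, L φ = ∫ x, φ x * h x ∂ν) ∧
      HasFDerivAt (fun g : HolderSpace M α => pressure μ g) L f := by
  have hm := hd.isStationary hα0
  have := hm.isProbabilityMeasure
  refine ⟨integralCLM α (weighted ν h.toC), fun φ => ?_,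
    (hd.exists_isLogEigenpair hα0).hasFDerivAt_pressure hα0 hα1 hm⟩
  rw [integralCLM_apply, integral_weighted ν hd.pos]
  simp only [mul_comm]

end Eigendata

end

end RuelleThermo

theorem theorem3p2 {M : Type*} [MetricSpace M] [CompactSpace M] [MeasurableSpace M]
    [BorelSpace M] (μ : MeasureTheory.Measure M) [MeasureTheory.IsProbabilityMeasure μ]
    [μ.IsOpenPosMeasure] (α : ℝ) (hα0 : 0 < α) (hα1 : α < 1) :
    (∀ g : RuelleThermo.HolderSpace M α,
      RuelleThermo.pressureE μ g ≠ ⊤ ∧ RuelleThermo.pressureE μ g ≠ ⊥) ∧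
    ∀ f : RuelleThermo.HolderSpace M α,
      (∃! p : RuelleThermo.HolderSpace M α × MeasureTheory.Measure (ℕ → M),
        RuelleThermo.IsMaximalEigendata μ f p.1 p.2) ∧
      ∀ (h : RuelleThermo.HolderSpace M α) (ν : MeasureTheory.Measure (ℕ → M)),
        RuelleThermo.IsMaximalEigendata μ f h ν →
        DifferentiableAt ℝ (fun g : RuelleThermo.HolderSpace M α => RuelleThermo.pressure μ g) f ∧
        ∀ φ : RuelleThermo.HolderSpace M α,
          fderiv ℝ (fun g : RuelleThermo.HolderSpace M α => RuelleThermo.pressure μ g) f φ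
            = ∫ x, φ x * h x ∂ν := by
  have : Nonempty M := MeasureTheory.nonempty_of_isProbabilityMeasure μ
  refine ⟨fun g => ?_, fun f => ⟨?_, fun h ν hd => ?_⟩⟩
  · obtain ⟨u, c, hu⟩ := g.exists_isLogEigenpair (μ := μ) hα0
    rw [hu.pressureE_eq hα0 hα1.le]
    exact ⟨EReal.coe_ne_top c, EReal.coe_ne_bot c⟩
  · obtain ⟨h, ν, hd⟩ := RuelleThermo.exists_isMaximalEigendata μ hα0 hα1.le f
    refine ⟨(h, ν), hd, fun p hp => ?_⟩
    obtain ⟨h1, h2⟩ := RuelleThermo.IsMaximalEigendata.unique hα0 hα1.le hp hd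
    exact Prod.ext h1 h2
  · obtain ⟨L, hL, hderiv⟩ := hd.hasFDerivAt_pressure hα0 hα1.le
    refine ⟨hderiv.differentiableAt, fun φ => ?_⟩
    rw [hderiv.fderiv, hL]
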